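/- Let $\Bbbk$ be a field and let $\mathcal{C}$ be a $\Bbbk$-linear abelian category in which every object has finite length. Let $(\Lambda,\le)$ be a poset in which every set $\{\mu\mid\mu\le\lambda\}$ is finite, and let $L_\lambda$ ($\lambda\in\Lambda$) be representatives of the isomorphism classes of simple objects of $\mathcal{C}$. For $\lambda\in\Lambda$, let $\mathcal{C}_{\le\lambda}$ be the Serre subcategory of $\mathcal{C}$ generated by the $L_\mu$ with $\mu\le\lambda$. Suppose that $\mathcal{C}$ is a highest weight category with weight poset $\Lambda$, i.e. that for all $\lambda,\mu\in\Lambda$, the object $L_\lambda$ has a projective cover $\Delta_\lambda\to L_\lambda$ and an injective hull $L_\lambda\to\nabla_\lambda$ in $\mathcal{C}_{\le\lambda}$, that $\mathrm{Hom}_{\mathcal{C}}(\Delta_\lambda,\nabla_\lambda)\cong\Bbbk$, and that $\mathrm{Ext}^1_{\mathcal{C}}(\Delta_\lambda,\nabla_\mu)=0=\mathrm{Ext}^2_{\mathcal{C}}(\Delta_\lambda,\nabla_\mu)$. A tilting object is an object that has both a finite filtration with all subquotients isomorphic to objects $\Delta_\mu$ and a finite filtration with all subquotients isomorphic to objects $\nabla_\mu$.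 Let $\mathrm{Tilt}(\mathcal{C})$ be the full subcategory of tilting objects, and let $T_\lambda$ be the indecomposable tilting object (unique up to isomorphism) that belongs to $\mathcal{C}_{\le\lambda}$ and has composition multiplicity $[T_\lambda:L_\lambda]=1$. For an object $M$ and an indecomposable object $N$, let $[M:N]_\oplus$ be the number of summands isomorphic to $N$ in a decomposition of $M$ as a finite direct sum of indecomposable objects. The radical of a preadditive category $\mathcal{A}$ consists of the morphisms $f\colon A\to B$ such that $b\circ f\circ a$ lies in the Jacobson radical of $\mathrm{End}_{\mathcal{A}}(E)$ for all objects $E$ and all $a\colon E\to A$, $b\colon B\to E$. For an object $X$ of the bounded derived category $D^b(\mathcal{C})$, the minimal tilting complex $C_{\min}(X)$ is the bounded cochain complex of tilting objects (unique up to isomorphism of complexes) all of whose differentials lie in the radical of $\mathrm{Tilt}(\mathcal{C})$ and which is isomorphic to $X$ in $D^b(\mathcal{C})$; its term in degree $i$ is written $C_{\min}(X)_i$. Let $X\to Y\to Z\to X[1]$ be a distinguished triangle in $D^b(\mathcal{C})$. Then for every $i\in\mathbb{Z}$, the object $C_{\min}(Z)_i$ is (isomorphic to) a direct summand of $C_{\min}(X)_{i+1}\oplus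 C_{\min}(Y)_i$. Moreover, for every $i\in\mathbb{Z}$ and $\lambda\in\Lambda$, \[ [C_{\min}(X)_{i+1}:T_\lambda]_\oplus+[C_{\min}(Y)_i:T_\lambda]_\oplus\ \ge\ [C_{\min}(Z)_i:T_\lambda]_\oplus \] and \[ \begin{aligned} [C_{\min}(Z)_i:T_\lambda]_\oplus\ \ge\ {}&[C_{\min}(X)_{i+1}:T_\lambda]_\oplus-[C_{\min}(X)_i:T_\lambda]_\oplus-[C_{\min}(X)_{i+2}:T_\lambda]_\oplus\\ &+[C_{\min}(Y)_i:T_\lambda]_\oplus-[C_{\min}(Y)_{i-1}:T_\lambda]_\oplus-[C_{\min}(Y)_{i+1}:T_\lambda]_\oplus. \end{aligned} \] -/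

import Mathlib

open CategoryTheory CategoryTheory.Limits CategoryTheory.Pretriangulated

universe t t' w w' v u

noncomputable section

namespace MinTilt

section Radical

variable {A : Type u} [Category.{v} A] [Preadditive A]

/-- The radical of a preadditive category: `f : X ⟶ Y` lies in the radical if for all `a : Z ⟶ X`
and `b : Y ⟶ Z`, the endomorphism `b ∘ f ∘ a` lies in the Jacobson radical of `End Z`. -/
def InRadical {X Y : A} (f : X ⟶ Y) : Prop :=
  ∀ ⦃Z : A⦄ (a : Z ⟶ X) (b : Y ⟶ Z), End.of (a ≫ f ≫ b) ∈ Ring.jacobson (End Z)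

/-- A complex is minimal if all of its differentials lie in the radical. -/
def IsMinimalComplex (K : CochainComplex A ℤ) : Prop :=
  ∀ i : ℤ, InRadical (K.d i (i + 1))

/-- A complex is bounded if its terms vanish outside a finite range of degrees. -/
def IsBoundedComplex (K : CochainComplex A ℤ) : Prop :=
  ∃ a b : ℤ, ∀ i : ℤ, i < a ∨ b < i → IsZero (K.X i)

end Radical

section Covers

variable {A : Type u} [Category.{v} A]

/-- A projective cover of `X`: an essential epimorphism from a projective object to `X`. -/
structure IsProjectiveCover {P X : A} (p : P ⟶ X) : Prop where
  projective : Projective P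
  epi : Epi p
  essential : ∀ ⦃N : A⦄ (g : N ⟶ P), Epi (g ≫ p) → Epi g

/-- An injective hull of `X`: an essential monomorphism from `X` to an injective object. -/
structure IsInjectiveHull {X I : A} (j : X ⟶ I) : Prop where
  injective : Injective I
  mono : Mono j
  essential : ∀ ⦃N : A⦄ (g : I ⟶ N), Mono (j ≫ g) → Mono g

end Covers

variable {C : Type u} [Category.{v} C] [Abelian C]

/-- The Serre subcategory generated by a class of objects. -/
def serreClosure (P : ObjectProperty C) : ObjectProperty C :=
  fun X => ∀ Q : ObjectProperty C, Q.IsSerreClass → P ≤ Q → Q X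

/-- The Serre subcategory generated by the objects `L l` with `l ∈ Γ`. -/
def truncated {Λ : Type w} (L : Λ → C) (Γ : Set Λ) : ObjectProperty C :=
  serreClosure fun X => ∃ l ∈ Γ, Nonempty (X ≅ L l)

lemma truncated_of_mem {Λ : Type w} (L : Λ → C) {Γ : Set Λ} {l : Λ} (hl : l ∈ Γ) :
    truncated L Γ (L l) :=
  fun _ _ hQ => hQ _ ⟨l, hl, ⟨Iso.refl _⟩⟩

/-- A finite filtration `0 = M₀ ⊆ M₁ ⊆ ⋯ ⊆ Mᵣ = M`. -/
structure FiniteFiltration (M : C) where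
  length : ℕ
  step : Fin (length + 1) →o Subobject M
  step_zero : step 0 = ⊥
  step_last : step (Fin.last length) = ⊤

/-- The subquotient `Mᵢ₊₁ / Mᵢ` of a filtration. -/
def FiniteFiltration.subquotient {M : C} (F : FiniteFiltration M) (i : Fin F.length) : C :=
  cokernel (Subobject.ofLE (F.step i.castSucc) (F.step i.succ)
    (F.step.monotone i.castSucc_lt_succ.le))

/-- `M` has a finite filtration all of whose subquotients are isomorphic to objects `D l`. -/
def HasFiltrationBy {Λ : Type w} (D : Λ → C) (M : C) : Prop :=
  ∃ F : FiniteFiltration M, ∀ i, ∃ l, Nonempty (F.subquotient i ≅ D l)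

/-- The multiplicity `[M : S]` of a simple object `S` in a composition series of an object `M` of
finite length. It does not depend on the composition series (so the infimum below is over a set
with one element). -/
def compositionMultiplicity (M S : C) : ℕ :=
  sInf {m | ∃ F : FiniteFiltration M, (∀ i, Simple (F.subquotient i)) ∧
    m = Nat.card {i // Nonempty (F.subquotient i ≅ S)}}

attribute [local instance] Abelian.hasFiniteBiproducts

/-- `M ≅ N 1 ⊕ ⋯ ⊕ N n` with all `N i` indecomposable. -/
def IsKrullSchmidtDecomposition (M : C) {n : ℕ} (N : Fin n → C) : Prop :=
  (∀ i, Indecomposable (N i)) ∧ Nonempty (M ≅ ⨁ N)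

/-- The multiplicity `[M : N]_⊕` of an indecomposable object `N` in a Krull-Schmidt decomposition
of `M`. In a Krull-Schmidt category it does not depend on the decomposition (so the infimum below
is over a set with one element). -/
def summandMultiplicity (M N : C) : ℕ :=
  sInf {m | ∃ (n : ℕ) (f : Fin n → C), IsKrullSchmidtDecomposition M f ∧
    m = Nat.card {i // Nonempty (f i ≅ N)}}

/-- `M` is (isomorphic to) a direct summand of `N`. -/
def IsDirectSummand (M N : C) : Prop :=
  ∃ W : C, Nonempty (M ⊞ W ≅ N)

variable (k : Type w) [Field k] (C) [Linear k C] (Λ : Type w') [PartialOrder Λ]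

/-- The structure of a highest weight category with lower finite weight poset `Λ` on the `k`-linear
abelian category `C`. -/
structure HighestWeightCategory [HasExt.{t} C] where
  finite_Iic : ∀ l : Λ, (Set.Iic l).Finite
  isNoetherian : ∀ M : C, IsNoetherianObject M
  isArtinian : ∀ M : C, IsArtinianObject M
  /-- the simple objects -/
  L : Λ → C
  simple_L : ∀ l, Simple (L l)
  eq_of_iso : ∀ l m, Nonempty (L l ≅ L m) → l = m
  exists_iso : ∀ S : C, Simple S → ∃ l, Nonempty (S ≅ L l)
  /-- the standard object of highest weight `l`, as an object of `C_{≤ l}` -/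
  standard : ∀ l : Λ, (truncated L (Set.Iic l)).FullSubcategory
  /-- the costandard object of highest weight `l`, as an object of `C_{≤ l}` -/
  costandard : ∀ l : Λ, (truncated L (Set.Iic l)).FullSubcategory
  projectiveCover : ∀ l, ∃ p : standard l ⟶ ⟨L l, truncated_of_mem L Set.self_mem_Iic⟩,
    IsProjectiveCover p
  injectiveHull : ∀ l, ∃ j : ⟨L l, truncated_of_mem L Set.self_mem_Iic⟩ ⟶ costandard l,
    IsInjectiveHull j
  hom_standard_costandard : ∀ l, Nonempty (((standard l).obj ⟶ (costandard l).obj) ≃ₗ[k] k)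
  ext_one : ∀ l m, Subsingleton (Abelian.Ext (standard l).obj (costandard m).obj 1)
  ext_two : ∀ l m, Subsingleton (Abelian.Ext (standard l).obj (costandard m).obj 2)

namespace HighestWeightCategory

variable {k C Λ} [HasExt.{t} C] (H : HighestWeightCategory C k Λ)

/-- Tilting objects: objects with both a `Δ`-filtration and a `∇`-filtration. -/
def tilting : ObjectProperty C := fun M =>
  HasFiltrationBy (fun l => (H.standard l).obj) M ∧
    HasFiltrationBy (fun l => (H.costandard l).obj) M

/-- `T` is (isomorphic to) the indecomposable tilting object `T_l` of highest weight `l`. -/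
structure IsIndecomposableTilting (l : Λ) (T : C) : Prop where
  tilting : H.tilting T
  indecomposable : Indecomposable T
  mem_truncated : truncated H.L (Set.Iic l) T
  multiplicity : compositionMultiplicity T (H.L l) = 1

/-- The category of tilting objects, as a full subcategory. -/
abbrev Tilt : Type u := H.tilting.FullSubcategory

end HighestWeightCategory

/-- The bounded derived category: the full triangulated subcategory of the derived category
given by the objects which are isomorphic to bounded complexes (equivalently, bounded below and
bounded above for the canonical t-structure). -/
abbrev BoundedDerivedCategory [HasDerivedCategory.{t'} C] : Type _ :=
  (DerivedCategory.TStructure.t (C := C)).bounded.FullSubcategory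

variable {k C Λ}

/-- `K` is a minimal tilting complex of the object `X` of the bounded derived category: a bounded
complex of tilting objects whose differentials lie in the radical of the category of tilting
objects, and which is isomorphic to `X` in the derived category. -/
structure IsMinimalTiltingComplex [HasExt.{t} C] [HasDerivedCategory.{t'} C]
    (H : HighestWeightCategory C k Λ) (K : CochainComplex H.Tilt ℤ)
    (X : BoundedDerivedCategory C) : Prop where
  bounded : IsBoundedComplex K
  minimal : IsMinimalComplex K
  iso : Nonempty (DerivedCategory.Q.obj
    ((H.tilting.ι.mapHomologicalComplex (ComplexShape.up ℤ)).obj K) ≅ X.obj)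

end MinTilt

end

/-! Higher `Ext` groups between tilting objects vanish (`ext_tilting_eq_zero`), so morphisms in the
derived category between bounded complexes of tilting objects are homotopy classes of chain maps
(`mapBij_Qh_of_ext`). The morphism `X ⟶ Y` therefore lifts to a chain map `f` between minimal
complexes, and the cone of `f`, with terms `C_min(X)_{i+1} ⊕ C_min(Y)_i`, is homotopy equivalent to
`C_min(Z)`. An endomorphism of a minimal complex that is homotopic to the identity is, in each
degree, the identity plus an element of the Jacobson radical, hence invertible. So `C_min(Z)` is a
direct summand of the cone as a complex (`exists_retraction_mappingCone`), which gives the first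
claim and the upper bound. The complement is contractible, so its term of degree `i` is a summand of
the cone terms of degrees `i + 1` and `i - 1` (`isDirectSummand_kernel_of_homotopy`); counting
summands gives the lower bound.

Two ingredients need work. `Ext` vanishing is assumed in degrees 1 and 2 only and enough projectives
are not given: `exists_epi_of_extAcyclic` covers each object by one with `Ext¹(-, ∇) = 0`, after
which `ext_costd_eq_zero` shifts dimensions. Additivity of multiplicities comes from
`Hom`-finiteness: `summandMultiplicity_mul` computes them from dimensions of `Hom(T, M)` modulo the
radical. -/

noncomputable section

namespace MinTilt

section

/-! ### Serre subcategories generated by simple objects, via composition series -/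

section Built

variable {C : Type u} [Category.{v} C] [Abelian C] {Λ : Type w'}

/-- Objects with a finite filtration whose subquotients are the objects `L l` with `l ∈ Γ`. -/
inductive Built (L : Λ → C) (Γ : Set Λ) : ObjectProperty C
  | zero {X : C} (hX : IsZero X) : Built L Γ X
  | ext {X : C} {l : Λ} (hl : l ∈ Γ) (g : X ⟶ L l) (hg : Epi g) (h : Built L Γ (kernel g)) :
      Built L Γ X

variable {L : Λ → C} {Γ Γ' : Set Λ}

lemma Built.mono (hΓ : Γ ⊆ Γ') {X : C} (hX : Built L Γ X) : Built L Γ' X := by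
  induction hX with
  | zero hX => exact .zero hX
  | ext hl g hg _ ih => exact .ext (hΓ hl) g hg ih

lemma Built.exists_finite {X : C} (hX : Built L Γ X) :
    ∃ F : Set Λ, F.Finite ∧ F ⊆ Γ ∧ Built L F X := by
  induction hX with
  | zero hX => exact ⟨∅, Set.finite_empty, Set.empty_subset _, .zero hX⟩
  | @ext X l hl g hg _ ih =>
    obtain ⟨F, hF, hFΓ, h⟩ := ih
    exact ⟨insert l F, hF.insert l, Set.insert_subset hl hFΓ,
      .ext (Set.mem_insert l F) g hg (h.mono (Set.subset_insert l F))⟩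

/-- The restriction of the top quotient `g` to `Y` is zero or onto, so either `Y` or its
intersection with `kernel g` embeds in `kernel g`. -/
lemma Built.of_mono (hL : ∀ l ∈ Γ, Simple (L l)) {X Y : C} (hX : Built L Γ X)
    (i : Y ⟶ X) [Mono i] : Built L Γ Y := by
  induction hX generalizing Y with
  | zero hX => exact .zero (hX.of_mono i)
  | @ext X l hl g hg _ ih =>
    have := hL l hl
    by_cases h : i ≫ g = 0
    · have : Mono (kernel.lift g i h) := by
        apply mono_of_mono_fac (kernel.lift_ι g i h)
      exact ih (kernel.lift g i h)
    · refine .ext hl (i ≫ g) (epi_of_nonzero_to_simple h) ?_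
      have w : (kernel.ι (i ≫ g) ≫ i) ≫ g = 0 := by simp
      have : Mono (kernel.lift g (kernel.ι (i ≫ g) ≫ i) w) :=
        mono_of_mono_fac (kernel.lift_ι g _ w)
      exact ih (kernel.lift g _ w)

lemma Built.of_epi (hL : ∀ l ∈ Γ, Simple (L l)) {X Y : C} (hX : Built L Γ X)
    (p : X ⟶ Y) [Epi p] : Built L Γ Y := by
  induction hX generalizing Y with
  | zero hX => exact .zero (hX.of_epi p)
  | @ext X l hl g hg _ ih =>
    have := hL l hl
    -- The quotient of `Y` by the image of `kernel g` is a quotient of the simple object `L l`,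
    -- hence zero or isomorphic to it.
    let q := cokernel.π (kernel.ι g ≫ p)
    have hq : kernel.ι g ≫ p ≫ q = 0 := by
      rw [← Category.assoc]; exact cokernel.condition _
    let m : L l ⟶ cokernel (kernel.ι g ≫ p) :=
      (ShortComplex.exact_kernel g).gIsCokernel.desc (CokernelCofork.ofπ (p ≫ q) hq)
    have hm : g ≫ m = p ≫ q :=
      (ShortComplex.exact_kernel g).gIsCokernel.fac (CokernelCofork.ofπ (p ≫ q) hq)
        WalkingParallelPair.one
    have : Epi m := epi_of_epi_fac hm
    have hex := ShortComplex.exact_cokernel (kernel.ι g ≫ p)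
    by_cases h : m = 0
    · have hq0 : q = 0 := by
        rw [← cancel_epi p, ← hm, h]; simp
      have : Epi (kernel.ι g ≫ p) := hex.epi_f hq0
      exact ih (kernel.ι g ≫ p)
    · have := isIso_of_epi_of_nonzero h
      refine .ext hl (q ≫ inv m) inferInstance ?_
      have w : (kernel.ι g ≫ p) ≫ q ≫ inv m = 0 := by
        rw [Category.assoc, ← Category.assoc p, ← hm]; simp
      have hex' : (ShortComplex.mk _ _ w).Exact := by
        have e : ShortComplex.mk (kernel.ι g ≫ p) q (cokernel.condition _) ≅
            ShortComplex.mk _ _ w :=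
          ShortComplex.isoMk (Iso.refl _) (Iso.refl _) (asIso m).symm
        exact ShortComplex.exact_of_iso e hex
      have : Epi (kernel.lift _ _ w) := (ShortComplex.exact_iff_epi_kernel_lift _).1 hex'
      exact ih (kernel.lift _ _ w)

/-- Induction on a composition series of `X₃`: `kernel (g ≫ g')` is an extension of `kernel g'` by
`X₁`. The short exact sequence is unbundled so that `X₃` can vary in the induction. -/
lemma Built.extension_aux (hL : ∀ l ∈ Γ, Simple (L l)) {X₁ X₂ X₃ : C} (f : X₁ ⟶ X₂)
    (g : X₂ ⟶ X₃) (w : f ≫ g = 0) (hS : (ShortComplex.mk f g w).ShortExact)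
    (h₁ : Built L Γ X₁) (h₃ : Built L Γ X₃) : Built L Γ X₂ := by
  induction h₃ generalizing X₂ with
  | zero hX =>
    have : Epi f := hS.exact.epi_f (hX.eq_of_tgt _ _)
    exact h₁.of_epi hL f
  | @ext X₃ l hl g' hg' _ ih =>
    have := hS.epi_g
    have := hS.mono_f
    dsimp at *
    refine .ext hl (g ≫ g') inferInstance ?_
    have w₁ : f ≫ g ≫ g' = 0 := by rw [← Category.assoc, w, zero_comp]
    have w₂ : (kernel.ι (g ≫ g') ≫ g) ≫ g' = 0 := by simp
    have w₃ : kernel.lift _ f w₁ ≫ kernel.lift _ _ w₂ = 0 := by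
      rw [← cancel_mono (kernel.ι g')]; simp [w]
    refine ih (kernel.lift _ f w₁) (kernel.lift _ _ w₂) w₃ ?_
    have : Mono (kernel.lift (g ≫ g') f w₁) := mono_of_mono_fac (kernel.lift_ι _ f w₁)
    have hepi : Epi (kernel.lift g' _ w₂) := by
      rw [epi_iff_surjective_up_to_refinements]
      intro A y
      obtain ⟨A', π, hπ, x, hx⟩ := surjective_up_to_refinements_of_epi g (y ≫ kernel.ι g')
      refine ⟨A', π, hπ, kernel.lift _ x ?_, ?_⟩
      · rw [← Category.assoc, ← hx]; simp
      · rw [← cancel_mono (kernel.ι g')]; simpa using hx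
    refine { exact := ?_, mono_f := this, epi_g := hepi }
    rw [ShortComplex.exact_iff_exact_up_to_refinements]
    intro A x hx
    dsimp at x hx
    have hx' : (x ≫ kernel.ι (g ≫ g')) ≫ g = 0 := by
      simpa using hx =≫ kernel.ι g'
    refine ⟨A, 𝟙 A, inferInstance, hS.exact.lift (x ≫ kernel.ι _) hx', ?_⟩
    rw [← cancel_mono (kernel.ι (g ≫ g'))]
    have := hS.exact.lift_f (x ≫ kernel.ι _) hx'
    dsimp at this ⊢
    simp [this]

lemma Built.extension (hL : ∀ l ∈ Γ, Simple (L l)) {S : ShortComplex C} (hS : S.ShortExact)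
    (h₁ : Built L Γ S.X₁) (h₃ : Built L Γ S.X₃) : Built L Γ S.X₂ :=
  Built.extension_aux hL S.f S.g S.zero hS h₁ h₃

lemma Built.of_simple {l : Λ} (hl : l ∈ Γ) : Built L Γ (L l) :=
  .ext hl (𝟙 _) inferInstance (.zero (isZero_kernel_of_mono _))

lemma isSerreClass_built (hL : ∀ l ∈ Γ, Simple (L l)) : (Built L Γ).IsSerreClass where
  exists_zero := ⟨_, isZero_zero C, .zero (isZero_zero C)⟩
  prop_of_mono i _ h := h.of_mono hL i
  prop_of_epi p _ h := h.of_epi hL p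
  prop_X₂_of_shortExact hS h₁ h₃ := Built.extension hL hS h₁ h₃

lemma truncated_iff_built (hL : ∀ l ∈ Γ, Simple (L l)) (X : C) :
    truncated L Γ X ↔ Built L Γ X := by
  constructor
  · intro h
    refine h _ (isSerreClass_built hL) ?_
    rintro Y ⟨l, hl, ⟨e⟩⟩
    exact (Built.of_simple hl).of_mono hL e.hom
  · intro h Q hQ hPQ
    induction h with
    | zero hX => exact ObjectProperty.prop_of_isZero _ hX
    | @ext X l hl g hg _ ih =>
      refine ObjectProperty.prop_X₂_of_shortExact Q
        (S := ShortComplex.mk (kernel.ι g) g (kernel.condition g)) ?_ ih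
        (hPQ _ ⟨l, hl, ⟨Iso.refl _⟩⟩)
      exact { exact := ShortComplex.exact_kernel g }

lemma built_univ (hC : ∀ X : C, IsNoetherianObject X) (hC' : ∀ X : C, IsArtinianObject X)
    (hL : ∀ l, Simple (L l)) (hL' : ∀ S : C, Simple S → ∃ l, Nonempty (S ≅ L l)) (X : C) :
    Built L Set.univ X := by
  -- Noetherian induction on the kernels of the quotients `D` of `X`: dividing out a simple
  -- subobject of `D` strictly enlarges the kernel.
  suffices ∀ (Y : Subobject X) (D : C) (p : X ⟶ D), Epi p → kernelSubobject p = Y →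
      Built L Set.univ D from this _ X (𝟙 X) inferInstance rfl
  have := hC X
  intro Y
  induction Y using WellFoundedGT.induction with
  | ind Y ih =>
  intro D p hp hY
  by_cases hD : IsZero D
  · exact .zero hD
  have := hC' D
  obtain ⟨S, hS⟩ := exists_simple_subobject hD
  let d := cokernel.π S.arrow
  have hlt : Y < kernelSubobject (p ≫ d) := by
    refine lt_of_le_of_ne ?_ ?_
    · rw [← hY]
      exact le_kernelSubobject _ _ (by simp)
    · intro h
      have : Mono d := by
        rw [Preadditive.mono_iff_cancel_zero]
        intro A e he
        obtain ⟨A', π, hπ, x, hx⟩ := surjective_up_to_refinements_of_epi p e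
        have hf : (kernelSubobject (p ≫ d)).Factors x := by
          rw [kernelSubobject_factors_iff, ← Category.assoc, ← hx, Category.assoc, he, comp_zero]
        rw [← h, ← hY, kernelSubobject_factors_iff, ← hx] at hf
        rw [← cancel_epi π, hf, comp_zero]
      have h0 : S.arrow = 0 := by
        rw [← cancel_mono d]; simp [d]
      exact Simple.not_isZero (S : C) (IsZero.of_mono_eq_zero _ h0)
  obtain ⟨l, ⟨e⟩⟩ := hL' _ hS
  refine Built.extension (fun l _ => hL l)
    (S := ShortComplex.mk S.arrow d (cokernel.condition _))
    { exact := ShortComplex.exact_cokernel _ } ?_ (ih _ hlt _ (p ≫ d) inferInstance rfl)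
  exact (Built.of_simple (Set.mem_univ l)).of_mono (fun l _ => hL l) e.hom

end Built

end

section

/-! ### Effaceability of `Ext` and long exact sequence arguments -/

section ExtTools

open Abelian DerivedCategory HomologicalComplex

variable {C : Type u} [Category.{v} C] [Abelian C]

/-- As `K` vanishes in positive degrees, `K.X 0` surjects onto `H⁰(K) ≅ X` and includes into `K` as
a subcomplex concentrated in degree 0. -/
lemma exists_epi_of_quasiIso_single {X : C} {K : CochainComplex C ℤ} [K.IsStrictlyLE 0]
    (s : K ⟶ (single C (ComplexShape.up ℤ) 0).obj X) [QuasiIso s] :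
    ∃ (p : K.X 0 ⟶ X) (j : (single C (ComplexShape.up ℤ) 0).obj (K.X 0) ⟶ K), Epi p ∧
      j ≫ s = (single C (ComplexShape.up ℤ) 0).map p := by
  have hK : K.d 0 1 = 0 := (K.isZero_of_isStrictlyLE 0 1 (by simp)).eq_of_tgt _ _
  let e := K.iCyclesIso 0 1 (by simp) hK
  let α := e.inv ≫ K.homologyπ 0 ≫ homologyMap s 0 ≫ (singleObjHomologySelfIso _ _ _).hom
  have hα : s.f 0 = α ≫ (singleObjXSelf (ComplexShape.up ℤ) 0 X).inv := by
    rw [← cancel_epi e.hom]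
    dsimp [α, e]
    rw [Category.assoc, Category.assoc, Category.assoc, Iso.hom_inv_id_assoc,
      homologyπ_naturality_assoc, homologyπ_singleObjHomologySelfIso_hom_assoc,
      ← singleObjCyclesSelfIso_inv_iCycles, Iso.hom_inv_id_assoc]
    exact (cyclesMap_i s 0).symm
  have hepi : Epi α := inferInstance
  refine ⟨α, mkHomFromSingle (𝟙 _) ?_, hepi, ?_⟩
  · rintro _ rfl
    apply (K.isZero_of_isStrictlyLE 0 (0 + 1) (by simp)).eq_of_tgt
  · apply HomologicalComplex.from_single_hom_ext
    rw [comp_f, mkHomFromSingle_f, Category.assoc, hα, single_map_f_self]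
    simp

lemma comp_eq_zero_of_single {X Y : C} {K : CochainComplex C ℤ} {i j : ℤ} (hij : i ≠ j)
    (f : (single C (ComplexShape.up ℤ) i).obj X ⟶ K)
    (g : K ⟶ (single C (ComplexShape.up ℤ) j).obj Y) : f ≫ g = 0 := by
  apply HomologicalComplex.from_single_hom_ext
  exact (isZero_single_obj_X _ _ _ _ hij).eq_of_tgt _ _

/-- In a right fraction representing `φ`, the roof `K` can be taken in degrees `≤ 0`. On its degree
0 term the numerator vanishes, since its target sits in degree `i ≠ 0`. -/
lemma exists_epi_map_comp_eq_zero [HasDerivedCategory.{t'} C] {X Y : C} (i : ℤ) (hi : i < 0)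
    (φ : Q.obj ((CochainComplex.singleFunctor C 0).obj X) ⟶
      Q.obj ((CochainComplex.singleFunctor C i).obj Y)) :
    ∃ (X' : C) (p : X' ⟶ X), Epi p ∧
      Q.map ((CochainComplex.singleFunctor C 0).map p) ≫ φ = 0 := by
  obtain ⟨K, _, s, h, g, rfl⟩ := right_fac_of_isStrictlyLE φ 0
  rw [isIso_Q_map_iff_quasiIso] at h
  have hQ := (isIso_Q_map_iff_quasiIso C s).2 h
  have h' : QuasiIso (C := C) (c := ComplexShape.up ℤ) (K := K)
      (L := (single C (ComplexShape.up ℤ) 0).obj X) s := h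
  obtain ⟨p, j, hp, hj⟩ : ∃ (p : K.X 0 ⟶ X)
      (j : (CochainComplex.singleFunctor C 0).obj (K.X 0) ⟶ K), Epi p ∧
      j ≫ s = (CochainComplex.singleFunctor C 0).map p :=
    exists_epi_of_quasiIso_single (K := K) (X := X) s
  refine ⟨K.X 0, p, hp, ?_⟩
  have hj' : Q.map ((CochainComplex.singleFunctor C 0).map p) = Q.map j ≫ Q.map s := by
    rw [← Q.map_comp, hj]
  have hg : j ≫ g = 0 := comp_eq_zero_of_single (by lia) j g
  rw [hj', Category.assoc, IsIso.hom_inv_id_assoc, ← Q.map_comp, hg, Q.map_zero]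

lemma shortExact_kernel {X Y : C} (g : X ⟶ Y) [Epi g] :
    (ShortComplex.mk (kernel.ι g) g (kernel.condition g)).ShortExact :=
  { exact := ShortComplex.exact_kernel g }

lemma shortExact_cokernel {X Y : C} (f : X ⟶ Y) [Mono f] :
    (ShortComplex.mk f (cokernel.π f) (cokernel.condition f)).ShortExact :=
  { exact := ShortComplex.exact_cokernel f }

variable [HasExt.{t} C]

/-- Positive degree `Ext` classes are effaceable in the first variable. -/
lemma exists_epi_mk₀_comp_eq_zero {X Y : C} {n : ℕ} (x : Ext X Y (n + 1)) :
    ∃ (X' : C) (p : X' ⟶ X), Epi p ∧ (Ext.mk₀ p).comp x (zero_add (n + 1)) = 0 := by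
  let := HasDerivedCategory.standard C
  let ψ := ((singleFunctors C).shiftIso (n + 1) (-(n + 1)) 0 (by lia)).hom.app Y
  obtain ⟨X', p, hp, h⟩ := exists_epi_map_comp_eq_zero (X := X) (Y := Y) (-(n + 1)) (by lia)
    (x.hom ≫ ψ)
  refine ⟨X', p, hp, ?_⟩
  apply Ext.homEquiv.injective
  change Ext.hom _ = Ext.hom _
  rw [Ext.comp_hom, Ext.mk₀_hom, Ext.zero_hom, ShiftedHom.mk₀_comp, ← cancel_mono ψ,
    Limits.zero_comp, Category.assoc]
  exact h

/-- Every class in `Ext¹` is the class of a short exact sequence. -/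
lemma exists_shortExact_extClass_eq {X Y : C} (x : Ext X Y 1) :
    ∃ (E : C) (f : Y ⟶ E) (g : E ⟶ X) (w : f ≫ g = 0)
      (hS : (ShortComplex.mk f g w).ShortExact), hS.extClass = x := by
  obtain ⟨X', p, hp, hx⟩ := exists_epi_mk₀_comp_eq_zero (n := 0) x
  have hK : (ShortComplex.mk (kernel.ι p) p (kernel.condition p)).ShortExact :=
    { exact := ShortComplex.exact_kernel p }
  obtain ⟨y, hy⟩ := Ext.contravariant_sequence_exact₃ hK _ x hx (add_zero 1)
  obtain ⟨y, rfl⟩ : ∃ y' : kernel p ⟶ Y, Ext.mk₀ y' = y := (Ext.mk₀_bijective _ _).2 y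
  -- The wanted extension is the pushout of `kernel p ⟶ X' ⟶ X` along `y`; naturality of the
  -- extension class identifies its class with `x`.
  let g : pushout (kernel.ι p) y ⟶ X := pushout.desc p 0 (by simp)
  have hg : pushout.inl (kernel.ι p) y ≫ g = p := pushout.inl_desc _ _ _
  have w : pushout.inr (kernel.ι p) y ≫ g = 0 := pushout.inr_desc _ _ _
  have hepi : Epi g := epi_of_epi_fac hg
  have hS : (ShortComplex.mk (pushout.inr (kernel.ι p) y) g w).ShortExact := by
    refine { exact := ShortComplex.exact_of_g_is_cokernel _ ?_ }
    refine CokernelCofork.IsColimit.ofπ' g w fun {Z} k hk => ?_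
    have h0 : kernel.ι p ≫ pushout.inl _ _ ≫ k = 0 := by
      rw [pushout.condition_assoc, hk, comp_zero]
    refine ⟨hK.gIsCokernel.desc (CokernelCofork.ofπ _ h0), ?_⟩
    apply pushout.hom_ext
    · rw [← Category.assoc, hg]
      exact hK.gIsCokernel.fac (CokernelCofork.ofπ _ h0) WalkingParallelPair.one
    · rw [← Category.assoc, w, zero_comp, hk]
  refine ⟨_, _, g, w, hS, ?_⟩
  have := ShortComplex.ShortExact.extClass_naturality hK hS
    { τ₁ := y, τ₂ := pushout.inl _ _, τ₃ := 𝟙 X, comm₁₂ := pushout.condition.symm }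
  dsimp at this hy
  rw [Ext.mk₀_id_comp, hy] at this
  exact this.symm

lemma subsingleton_ext_zero_iff {X Y : C} :
    Subsingleton (Ext X Y 0) ↔ ∀ f : X ⟶ Y, f = 0 := by
  rw [Ext.homEquiv₀.subsingleton_congr]
  exact ⟨fun h f => Subsingleton.elim _ _, fun h => ⟨fun f g => (h f).trans (h g).symm⟩⟩

variable {S : ShortComplex C} {X Y : C} {n : ℕ}

lemma ext_left_X₂ (hS : S.ShortExact) (h₁ : Subsingleton (Ext S.X₁ Y n))
    (h₃ : Subsingleton (Ext S.X₃ Y n)) :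
    Subsingleton (Ext S.X₂ Y n) := by
  refine subsingleton_of_forall_eq 0 fun x => ?_
  obtain ⟨y, rfl⟩ := Ext.contravariant_sequence_exact₂ hS _ x (Subsingleton.elim _ _)
  rw [Subsingleton.elim y 0, Ext.comp_zero]

lemma ext_left_X₁ (hS : S.ShortExact) (h₂ : Subsingleton (Ext S.X₂ Y n))
    (h₃ : Subsingleton (Ext S.X₃ Y (n + 1))) :
    Subsingleton (Ext S.X₁ Y n) := by
  refine subsingleton_of_forall_eq 0 fun x => ?_
  obtain ⟨y, rfl⟩ := Ext.contravariant_sequence_exact₁ hS _ x (add_comm 1 n)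
    (Subsingleton.elim _ _)
  rw [Subsingleton.elim y 0, Ext.comp_zero]

lemma ext_right_X₂ (hS : S.ShortExact) (h₁ : Subsingleton (Ext X S.X₁ n))
    (h₃ : Subsingleton (Ext X S.X₃ n)) :
    Subsingleton (Ext X S.X₂ n) := by
  refine subsingleton_of_forall_eq 0 fun x => ?_
  obtain ⟨y, rfl⟩ := Ext.covariant_sequence_exact₂ _ hS x (Subsingleton.elim _ _)
  rw [Subsingleton.elim y 0, Ext.zero_comp]

lemma ext_right_X₁ (hS : S.ShortExact) (h₃ : Subsingleton (Ext X S.X₃ n))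
    (h₂ : Subsingleton (Ext X S.X₂ (n + 1))) :
    Subsingleton (Ext X S.X₁ (n + 1)) := by
  refine subsingleton_of_forall_eq 0 fun x => ?_
  obtain ⟨y, rfl⟩ := Ext.covariant_sequence_exact₁ _ hS x (Subsingleton.elim _ _) rfl
  rw [Subsingleton.elim y 0, Ext.zero_comp]

lemma ext_left_of_retract {X' : C} (i : X ⟶ X') (r : X' ⟶ X) (hir : i ≫ r = 𝟙 X)
    (h : Subsingleton (Ext X' Y n)) : Subsingleton (Ext X Y n) := by
  refine subsingleton_of_forall_eq 0 fun x => ?_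
  have : x = (Ext.mk₀ i).comp ((Ext.mk₀ r).comp x (zero_add n)) (zero_add n) := by
    rw [Ext.mk₀_comp_mk₀_assoc, hir, Ext.mk₀_id_comp]
  rw [this, Subsingleton.elim ((Ext.mk₀ r).comp x (zero_add n)) 0, Ext.comp_zero]

lemma ext_right_of_retract {Y' : C} (i : Y ⟶ Y') (r : Y' ⟶ Y) (hir : i ≫ r = 𝟙 Y)
    (h : Subsingleton (Ext X Y' n)) : Subsingleton (Ext X Y n) := by
  refine subsingleton_of_forall_eq 0 fun x => ?_
  have : x = (x.comp (Ext.mk₀ i) (add_zero n)).comp (Ext.mk₀ r) (add_zero n) := by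
    rw [Ext.comp_assoc_of_third_deg_zero, Ext.mk₀_comp_mk₀, hir, Ext.comp_mk₀_id]
  rw [this, Subsingleton.elim (x.comp (Ext.mk₀ i) (add_zero n)) 0, Ext.zero_comp]

lemma ext_left_of_isZero (hX : IsZero X) : Subsingleton (Ext X Y n) := by
  refine subsingleton_of_forall_eq 0 fun x => ?_
  rw [← Ext.mk₀_id_comp x, hX.eq_of_src (𝟙 X) 0, Ext.mk₀_zero, Ext.zero_comp]

lemma ext_right_of_isZero (hY : IsZero Y) : Subsingleton (Ext X Y n) := by
  refine subsingleton_of_forall_eq 0 fun x => ?_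
  rw [← Ext.comp_mk₀_id x, hY.eq_of_src (𝟙 Y) 0, Ext.mk₀_zero, Ext.comp_zero]

lemma ext_left_of_iso {X' : C} (e : X ≅ X') (h : Subsingleton (Ext X' Y n)) :
    Subsingleton (Ext X Y n) :=
  ext_left_of_retract e.hom e.inv e.hom_inv_id h

lemma ext_right_of_iso {Y' : C} (e : Y ≅ Y') (h : Subsingleton (Ext X Y' n)) :
    Subsingleton (Ext X Y n) :=
  ext_right_of_retract e.hom e.inv e.hom_inv_id h

variable {Λ : Type w'} {L : Λ → C} {Γ : Set Λ}

lemma Built.ext_right (h : ∀ l ∈ Γ, Subsingleton (Ext X (L l) n)) (hY : Built L Γ Y) :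
    Subsingleton (Ext X Y n) := by
  induction hY with
  | zero hX => exact ext_right_of_isZero hX
  | @ext X l hl g hg _ ih => exact ext_right_X₂ (shortExact_kernel g) ih (h l hl)

end ExtTools

end

section

/-! ### Standard and costandard objects; `Hom`-finiteness -/

section HighestWeight

open Abelian

lemma finite_of_finite_ker {k : Type w} [Field k] {V W : Type*} [AddCommGroup V] [Module k V]
    [AddCommGroup W] [Module k W] (f : V →ₗ[k] W) [Module.Finite k W]
    (h : Module.Finite k (LinearMap.ker f)) : Module.Finite k V := by
  refine ⟨Submodule.fg_of_fg_map_of_fg_inf_ker f ?_ ?_⟩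
  · exact (inferInstance : IsNoetherian k W).noetherian _
  · rw [top_inf_eq]
    exact (Module.Finite.iff_fg).1 h

variable {C : Type u} [Category.{v} C] [Abelian C] {k : Type w} [Field k] [Linear k C]
  {Λ : Type w'} [PartialOrder Λ] [HasExt.{t} C]

namespace HighestWeightCategory

variable (H : HighestWeightCategory C k Λ)

/-- The standard object of highest weight `l`. -/
abbrev std (l : Λ) : C := (H.standard l).obj

/-- The costandard object of highest weight `l`. -/
abbrev costd (l : Λ) : C := (H.costandard l).obj

lemma built_iff {l : Λ} {X : C} : truncated H.L (Set.Iic l) X ↔ Built H.L (Set.Iic l) X :=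
  truncated_iff_built (fun l _ => H.simple_L l) X

lemma built_std (l : Λ) : Built H.L (Set.Iic l) (H.std l) := H.built_iff.1 (H.standard l).property

lemma built_costd (l : Λ) : Built H.L (Set.Iic l) (H.costd l) :=
  H.built_iff.1 (H.costandard l).property

lemma built_of_mono {Γ : Set Λ} {X Y : C} (hX : Built H.L Γ X) (i : Y ⟶ X) [Mono i] :
    Built H.L Γ Y := hX.of_mono (fun l _ => H.simple_L l) i

lemma built_of_epi {Γ : Set Λ} {X Y : C} (hX : Built H.L Γ X) (p : X ⟶ Y) [Epi p] :
    Built H.L Γ Y := hX.of_epi (fun l _ => H.simple_L l) p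

lemma built_all (X : C) : Built H.L Set.univ X :=
  built_univ H.isNoetherian H.isArtinian H.simple_L H.exists_iso X

lemma std_lift {l : Λ} {X Y : C} (hX : Built H.L (Set.Iic l) X) (e : X ⟶ Y) [Epi e]
    (f : H.std l ⟶ Y) : ∃ f' : H.std l ⟶ X, f' ≫ e = f := by
  obtain ⟨p, hp⟩ := H.projectiveCover l
  have := hp.projective
  let X' : (truncated H.L (Set.Iic l)).FullSubcategory := ⟨X, H.built_iff.2 hX⟩
  let Y' : (truncated H.L (Set.Iic l)).FullSubcategory :=
    ⟨Y, H.built_iff.2 (H.built_of_epi hX e)⟩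
  let e' : X' ⟶ Y' := ObjectProperty.homMk e
  have : Epi e' := ⟨fun u v h => by
    ext
    exact (cancel_epi e).1 (congrArg (·.hom) h)⟩
  let f' : H.standard l ⟶ Y' := ObjectProperty.homMk f
  exact ⟨(Projective.factorThru f' e').hom, congrArg (·.hom) (Projective.factorThru_comp f' e')⟩

lemma costd_extend {l : Λ} {X Y : C} (hY : Built H.L (Set.Iic l) Y) (i : X ⟶ Y) [Mono i]
    (f : X ⟶ H.costd l) : ∃ f' : Y ⟶ H.costd l, i ≫ f' = f := by
  obtain ⟨p, hp⟩ := H.injectiveHull l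
  have := hp.injective
  let X' : (truncated H.L (Set.Iic l)).FullSubcategory :=
    ⟨X, H.built_iff.2 (H.built_of_mono hY i)⟩
  let Y' : (truncated H.L (Set.Iic l)).FullSubcategory := ⟨Y, H.built_iff.2 hY⟩
  let i' : X' ⟶ Y' := ObjectProperty.homMk i
  have : Mono i' := ⟨fun u v h => by
    ext
    exact (cancel_mono i).1 (congrArg (·.hom) h)⟩
  let f' : X' ⟶ H.costandard l := ObjectProperty.homMk f
  exact ⟨(Injective.factorThru f' i').hom, congrArg (·.hom) (Injective.comp_factorThru f' i')⟩

/-- Transfers the projective cover from `C_{≤ l}` to `C`. Cokernels and images formed in `C` stay in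
the Serre subcategory, so epimorphisms agree; for an `N` outside it, the image of `g` serves as test
object. -/
lemma exists_proj (l : Λ) : ∃ p : H.std l ⟶ H.L l, Epi p ∧
    ∀ ⦃N : C⦄ (g : N ⟶ H.std l), Epi (g ≫ p) → Epi g := by
  obtain ⟨p, hp⟩ := H.projectiveCover l
  have hpe := hp.epi
  refine ⟨p.hom, ?_, ?_⟩
  · refine Abelian.epi_of_cokernel_π_eq_zero _ ?_
    let Y' : (truncated H.L (Set.Iic l)).FullSubcategory := ⟨cokernel p.hom,
      H.built_iff.2 (H.built_of_epi (Built.of_simple (Set.self_mem_Iic)) (cokernel.π p.hom))⟩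
    let c : ⟨H.L l, truncated_of_mem H.L Set.self_mem_Iic⟩ ⟶ Y' :=
      ObjectProperty.homMk (cokernel.π p.hom)
    have : c = 0 := by
      rw [← cancel_epi p]
      ext
      change p.hom ≫ cokernel.π p.hom = p.hom ≫ 0
      simp
    exact congrArg (·.hom) this
  · intro N g hg
    let N' : (truncated H.L (Set.Iic l)).FullSubcategory := ⟨Limits.image g,
      H.built_iff.2 (H.built_of_mono (H.built_std l) (Limits.image.ι g))⟩
    let g' : N' ⟶ H.standard l := ObjectProperty.homMk (Limits.image.ι g)
    have he : Epi (Limits.image.ι g ≫ p.hom) := by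
      have : Epi (factorThruImage g ≫ Limits.image.ι g ≫ p.hom) := by
        rw [Limits.image.fac_assoc]; exact hg
      exact epi_of_epi (factorThruImage g) _
    have : Epi (g' ≫ p) := ⟨fun u v h => by
      ext
      exact (cancel_epi (Limits.image.ι g ≫ p.hom)).1 (congrArg (·.hom) h)⟩
    have hg' := hp.essential g' this
    have : Epi (Limits.image.ι g) := by
      refine Abelian.epi_of_cokernel_π_eq_zero _ ?_
      let Y' : (truncated H.L (Set.Iic l)).FullSubcategory := ⟨cokernel (Limits.image.ι g),
        H.built_iff.2 (H.built_of_epi (H.built_std l) (cokernel.π _))⟩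
      let c : H.standard l ⟶ Y' := ObjectProperty.homMk (cokernel.π (Limits.image.ι g))
      have : c = 0 := by
        rw [← cancel_epi g']
        apply ObjectProperty.hom_ext
        change Limits.image.ι g ≫ cokernel.π (Limits.image.ι g) = Limits.image.ι g ≫ 0
        simp
      exact congrArg (·.hom) this
    rw [← Limits.image.fac g]
    infer_instance

lemma exists_incl (l : Λ) : ∃ j : H.L l ⟶ H.costd l, Mono j := by
  obtain ⟨j, hj⟩ := H.injectiveHull l
  have hjm := hj.mono
  refine ⟨j.hom, Abelian.mono_of_kernel_ι_eq_zero _ ?_⟩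
  let Y' : (truncated H.L (Set.Iic l)).FullSubcategory := ⟨kernel j.hom,
    H.built_iff.2 (H.built_of_mono (Built.of_simple (Set.self_mem_Iic)) (kernel.ι j.hom))⟩
  let c : Y' ⟶ ⟨H.L l, truncated_of_mem H.L Set.self_mem_Iic⟩ :=
    ObjectProperty.homMk (kernel.ι j.hom)
  have : c = 0 := by
    rw [← cancel_mono j]
    ext
    change kernel.ι j.hom ≫ j.hom = 0 ≫ j.hom
    simp
  exact congrArg (·.hom) this

/-- The projection of a standard object onto its simple quotient. -/
def proj (l : Λ) : H.std l ⟶ H.L l := (H.exists_proj l).choose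

/-- The inclusion of the simple subobject of a costandard object. -/
def incl (l : Λ) : H.L l ⟶ H.costd l := (H.exists_incl l).choose

instance (l : Λ) : Epi (H.proj l) := (H.exists_proj l).choose_spec.1

instance (l : Λ) : Mono (H.incl l) := (H.exists_incl l).choose_spec

instance (l : Λ) : Simple (H.L l) := H.simple_L l

lemma epi_of_epi_comp_proj {l : Λ} {N : C} (g : N ⟶ H.std l) (h : Epi (g ≫ H.proj l)) : Epi g :=
  (H.exists_proj l).choose_spec.2 g h

lemma proj_comp_incl_ne_zero (l : Λ) : H.proj l ≫ H.incl l ≠ 0 := by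
  intro h
  have h1 : H.incl l = 0 := by rw [← cancel_epi (H.proj l), h, comp_zero]
  exact id_nonzero (H.L l) (by rw [← cancel_mono (H.incl l), h1]; simp)

lemma hom_std_costd {l : Λ} (f : H.std l ⟶ H.costd l) :
    ∃ c : k, f = c • (H.proj l ≫ H.incl l) := by
  obtain ⟨e⟩ := H.hom_standard_costandard l
  have h : e (H.proj l ≫ H.incl l) ≠ 0 := by
    simpa using H.proj_comp_incl_ne_zero l
  refine ⟨e f * (e (H.proj l ≫ H.incl l))⁻¹, e.injective ?_⟩
  rw [map_smul, smul_eq_mul, inv_mul_cancel_right₀ h]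

/-- The kernel of a nonzero `f` either is killed by `proj l`, which forces `L m ≅ L l`, or maps onto
`L l` and so is all of `Δ_l` by essentiality. -/
lemma hom_std_simple {l m : Λ} (h : l ≠ m) (f : H.std l ⟶ H.L m) : f = 0 := by
  by_contra hf
  have := epi_of_nonzero_to_simple hf
  by_cases hk : kernel.ι f ≫ H.proj l = 0
  · obtain ⟨d, hfac⟩ : ∃ d : H.L m ⟶ H.L l, f ≫ d = H.proj l :=
      ⟨_, (shortExact_kernel f).gIsCokernel.fac (CokernelCofork.ofπ _ hk)
        WalkingParallelPair.one⟩
    have : Epi d := epi_of_epi_fac hfac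
    have hd : d ≠ 0 := by
      intro hd
      apply H.proj_comp_incl_ne_zero l
      rw [← hfac, hd]; simp
    have := isIso_of_epi_of_nonzero hd
    exact h (H.eq_of_iso l m ⟨(asIso d).symm⟩)
  · have := H.epi_of_epi_comp_proj (kernel.ι f) (epi_of_nonzero_to_simple hk)
    exact hf (by rw [← cancel_epi (kernel.ι f)]; simp)

lemma hom_std_eq_zero {l : Λ} {Γ : Set Λ} (hl : l ∉ Γ) {X : C} (hX : Built H.L Γ X) :
    Subsingleton (Ext (H.std l) X 0) := by
  refine hX.ext_right fun m hm => subsingleton_ext_zero_iff.2 fun f => ?_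
  exact H.hom_std_simple (by rintro rfl; exact hl hm) f

lemma built_Iio_of_hom_std {l : Λ} {X : C} (hX : Built H.L (Set.Iic l) X)
    (h : ∀ f : H.std l ⟶ X, f = 0) : Built H.L (Set.Iio l) X := by
  induction hX with
  | zero hX => exact .zero hX
  | @ext X m hm g hg hK ih =>
    refine .ext (lt_of_le_of_ne hm ?_) g hg (ih fun f => ?_)
    · rintro rfl
      have hX' : Built H.L (Set.Iic m) X := .ext hm g hg hK
      obtain ⟨p', hp'⟩ := H.std_lift hX' g (H.proj m)
      apply H.proj_comp_incl_ne_zero m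
      rw [← hp', h p']; simp
    · rw [← cancel_mono (kernel.ι g), h (f ≫ kernel.ι g), zero_comp]

lemma built_Iio_of_hom_costd {l : Λ} {X : C} (hX : Built H.L (Set.Iic l) X)
    (h : ∀ f : X ⟶ H.costd l, f = 0) : Built H.L (Set.Iio l) X := by
  induction hX with
  | zero hX => exact .zero hX
  | @ext X m hm g hg hK ih =>
    have hX' : Built H.L (Set.Iic l) X := .ext hm g hg hK
    refine .ext (lt_of_le_of_ne hm ?_) g hg (ih fun f => ?_)
    · rintro rfl
      apply H.proj_comp_incl_ne_zero m
      have : H.incl m = 0 := by rw [← cancel_epi g, h (g ≫ H.incl m), comp_zero]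
      rw [this, comp_zero]
    · obtain ⟨f', hf'⟩ := H.costd_extend hX' (kernel.ι g) f
      rw [← hf', h f', comp_zero]

/-- Here `Hom(Δ_l, ∇_l) ≅ k` enters: a map from `Δ_l` to `∇_l / L_l` lifts to a multiple of `proj l
≫ incl l`, hence is zero, so `L_l` is not a composition factor of the quotient. -/
lemma built_cokernel_incl (l : Λ) : Built H.L (Set.Iio l) (cokernel (H.incl l)) := by
  refine H.built_Iio_of_hom_std (H.built_of_epi (H.built_costd l) (cokernel.π _)) fun f => ?_
  obtain ⟨f', rfl⟩ := H.std_lift (H.built_costd l) (cokernel.π (H.incl l)) f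
  obtain ⟨c, rfl⟩ := H.hom_std_costd f'
  simp

lemma built_kernel_proj (l : Λ) : Built H.L (Set.Iio l) (kernel (H.proj l)) := by
  refine H.built_Iio_of_hom_costd (H.built_of_mono (H.built_std l) (kernel.ι _)) fun f => ?_
  obtain ⟨f', rfl⟩ := H.costd_extend (H.built_std l) (kernel.ι (H.proj l)) f
  obtain ⟨c, rfl⟩ := H.hom_std_costd f'
  simp

/-- Only `l = m` can give a nonzero space, and then it embeds into `Hom(Δ_l, ∇_l) ≅ k` by composing
with `proj l` and `incl l`. -/
lemma finite_hom_simple (l m : Λ) : Module.Finite k (H.L l ⟶ H.L m) := by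
  by_cases h : ∃ f : H.L l ⟶ H.L m, f ≠ 0
  · obtain ⟨f, hf⟩ := h
    have := epi_of_nonzero_to_simple hf
    have := isIso_of_epi_of_nonzero hf
    obtain rfl := H.eq_of_iso l m ⟨asIso f⟩
    obtain ⟨e⟩ := H.hom_standard_costandard l
    have : Module.Finite k (H.std l ⟶ H.costd l) := Module.Finite.equiv e.symm
    refine Module.Finite.of_injective
      ((Linear.rightComp k (H.std l) (H.incl l)).comp (Linear.leftComp k (H.L l) (H.proj l))) ?_
    intro a b hab
    change (H.proj l ≫ a) ≫ H.incl l = (H.proj l ≫ b) ≫ H.incl l at hab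
    rwa [cancel_mono, cancel_epi] at hab
  · push Not at h
    have : Subsingleton (H.L l ⟶ H.L m) := ⟨fun a b => (h a).trans (h b).symm⟩
    infer_instance

lemma finite_hom_simple_left (l : Λ) (Y : C) : Module.Finite k (H.L l ⟶ Y) := by
  induction H.built_all Y with
  | zero hX =>
    have : Subsingleton (H.L l ⟶ _) := ⟨fun a b => hX.eq_of_tgt a b⟩
    infer_instance
  | @ext Y m _ g hg _ ih =>
    have := H.finite_hom_simple l m
    refine finite_of_finite_ker (Linear.rightComp k (H.L l) g) ?_
    have hfac (f : LinearMap.ker (Linear.rightComp k (H.L l) g)) :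
        kernel.lift g f.1 f.2 ≫ kernel.ι g = f.1 := kernel.lift_ι _ _ _
    let φ : LinearMap.ker (Linear.rightComp k (H.L l) g) →ₗ[k] (H.L l ⟶ kernel g) :=
      { toFun f := kernel.lift g f.1 f.2
        map_add' a b := by
          rw [← cancel_mono (kernel.ι g), Preadditive.add_comp, hfac, hfac, hfac]; rfl
        map_smul' a b := by
          rw [← cancel_mono (kernel.ι g), Linear.smul_comp, hfac, hfac]; rfl }
    refine Module.Finite.of_injective φ fun a b hab => ?_
    have := hab =≫ kernel.ι g
    ext
    exact (hfac a).symm.trans (this.trans (hfac b))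

/-- A highest weight category is `Hom`-finite. -/
lemma finite_hom (H : HighestWeightCategory C k Λ) (X Y : C) : Module.Finite k (X ⟶ Y) := by
  induction H.built_all X with
  | zero hX =>
    have : Subsingleton (_ ⟶ Y) := ⟨fun a b => hX.eq_of_src a b⟩
    infer_instance
  | @ext X l _ g hg _ ih =>
    have := H.finite_hom_simple_left l Y
    refine finite_of_finite_ker (Linear.leftComp k Y (kernel.ι g)) ?_
    have hfac (f : LinearMap.ker (Linear.leftComp k Y (kernel.ι g))) :=
      (shortExact_kernel g).gIsCokernel.fac (CokernelCofork.ofπ f.1 f.2) WalkingParallelPair.one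
    change ∀ f : LinearMap.ker (Linear.leftComp k Y (kernel.ι g)), g ≫ _ = f.1 at hfac
    let φ : LinearMap.ker (Linear.leftComp k Y (kernel.ι g)) →ₗ[k] (H.L l ⟶ Y) :=
      { toFun f := (shortExact_kernel g).gIsCokernel.desc (CokernelCofork.ofπ f.1 f.2)
        map_add' a b := by
          rw [← cancel_epi g, Preadditive.comp_add, hfac, hfac, hfac]; rfl
        map_smul' a b := by
          rw [← cancel_epi g, Linear.comp_smul, hfac, hfac]; rfl }
    refine Module.Finite.of_injective φ fun a b hab => ?_
    have := g ≫= hab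
    ext
    exact (hfac a).symm.trans (this.trans (hfac b))

end HighestWeightCategory

end HighestWeight

end

/-! ### Vanishing of higher `Ext` from standard to costandard objects -/

section

lemma HasFiltrationBy.induction {C : Type u} [Category.{v} C] [Abelian C] {Λ : Type w'}
    {D : Λ → C} {M : C} (hM : HasFiltrationBy D M)
    (P : ObjectProperty C) [P.IsClosedUnderExtensions] [P.IsClosedUnderIsomorphisms]
    (h0 : ∀ X, IsZero X → P X) (hD : ∀ l, P (D l)) : P M := by
  obtain ⟨F, hF⟩ := hM
  have h (i : Fin (F.length + 1)) : P (F.step i : C) := by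
    induction i using Fin.induction with
    | zero =>
      rw [F.step_zero]
      exact h0 _ ((isZero_zero C).of_iso Subobject.botCoeIsoZero)
    | succ i ih =>
      obtain ⟨l, ⟨e⟩⟩ := hF i
      exact P.prop_X₂_of_shortExact
        (shortExact_cokernel (Subobject.ofLE (F.step i.castSucc) (F.step i.succ)
          (F.step.monotone i.castSucc_lt_succ.le))) ih (P.prop_of_iso e.symm (hD l))
  have := h (Fin.last _)
  rw [F.step_last] at this
  exact P.prop_of_iso (asIso (⊤ : Subobject M).arrow) this

section ExtVanishing

open Abelian

variable {C : Type u} [Category.{v} C] [Abelian C] {k : Type w} [Field k] [Linear k C]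
  {Λ : Type w'} [PartialOrder Λ] [HasExt.{t} C]

/-- `Ext` precomposed with a morphism, as a linear map. -/
def extLeftComp (k : Type w) [Field k] [Linear k C] {X Y : C} (g : X ⟶ Y) (Z : C) (n : ℕ) :
    Ext Y Z n →ₗ[k] Ext X Z n where
  toFun x := (Ext.mk₀ g).comp x (zero_add n)
  map_add' := by simp
  map_smul' := by simp

namespace HighestWeightCategory

variable (H : HighestWeightCategory C k Λ)

/-- Objects without first extensions by costandard objects. -/
def extAcyclic : ObjectProperty C := fun M => ∀ m, Subsingleton (Ext M (H.costd m) 1)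

lemma extAcyclic_std (l : Λ) : H.extAcyclic (H.std l) := H.ext_one l

lemma extAcyclic_X₂ {S : ShortComplex C} (hS : S.ShortExact) (h₁ : H.extAcyclic S.X₁)
    (h₃ : H.extAcyclic S.X₃) : H.extAcyclic S.X₂ :=
  fun m => ext_left_X₂ hS (h₁ m) (h₃ m)

lemma ext_one_std_simple {l m : Λ} (h : ¬ l < m) : Subsingleton (Ext (H.std l) (H.L m) 1) :=
  ext_right_X₁ (shortExact_cokernel (H.incl m))
    (H.hom_std_eq_zero (Γ := Set.Iio m) h (H.built_cokernel_incl m)) (H.ext_one l m)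

/-- Choose `l` minimal with `Hom(M, L_l) ≠ 0`. For `n < l`, both `Hom(M, ∇_n / L_n)` and `Ext¹(M,
∇_n)` vanish, hence so does `Ext¹(M, L_n)`. The obstruction to lifting `M ⟶ L_l` along `proj l` is
then zero, and the lift is onto by essentiality. -/
lemma exists_shortExact_std {M : C} (hM : H.extAcyclic M) (h0 : ¬ IsZero M) :
    ∃ (l : Λ) (g : M ⟶ H.std l), Epi g ∧ g ≠ 0 := by
  obtain ⟨l₀, g₀, hg₀⟩ : ∃ (l : Λ) (g : M ⟶ H.L l), g ≠ 0 := by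
    cases H.built_all M with
    | zero hX => exact (h0 hX).elim
    | @ext _ l _ g hg _ =>
      refine ⟨l, g, fun h => ?_⟩
      subst h
      exact Simple.not_isZero (H.L l) (IsZero.of_epi_zero M (H.L l))
  let s : Set Λ := {l | l ≤ l₀ ∧ ∃ g : M ⟶ H.L l, g ≠ 0}
  have hs : s.Finite := (H.finite_Iic l₀).subset fun l hl => hl.1
  obtain ⟨l, ⟨hl, g, hg⟩, hmin⟩ := hs.exists_minimal ⟨l₀, le_rfl, g₀, hg₀⟩
  have h0 (n : Λ) (hn : n < l) : Subsingleton (Ext M (H.L n) 0) := by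
    rw [subsingleton_ext_zero_iff]
    by_contra! h
    exact hn.not_ge (hmin ⟨hn.le.trans hl, h⟩ hn.le)
  have h1 (n : Λ) (hn : n < l) : Subsingleton (Ext M (H.L n) 1) :=
    ext_right_X₁ (shortExact_cokernel (H.incl n))
      ((H.built_cokernel_incl n).ext_right fun m hm => h0 m (lt_trans hm hn)) (hM n)
  have h2 : Subsingleton (Ext M (kernel (H.proj l)) 1) := (H.built_kernel_proj l).ext_right h1
  obtain ⟨x, hx⟩ := Ext.covariant_sequence_exact₃ M (shortExact_kernel (H.proj l)) (Ext.mk₀ g)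
    (zero_add 1) (Subsingleton.elim _ _)
  obtain ⟨x, rfl⟩ : ∃ x' : M ⟶ H.std l, Ext.mk₀ x' = x := (Ext.mk₀_bijective _ _).2 x
  dsimp at hx
  rw [Ext.mk₀_comp_mk₀] at hx
  replace hx := (Ext.mk₀_bijective _ _).1 hx
  refine ⟨l, x, H.epi_of_epi_comp_proj x ?_, ?_⟩
  · rw [hx]; exact epi_of_nonzero_to_simple hg
  · rintro rfl
    exact hg (by rw [← hx, zero_comp])

/-- Repeatedly splits off a standard quotient; the kernel stays acyclic because `Ext²(Δ, ∇) = 0`,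
and the process stops since `M` is Artinian. Acyclic objects are thus iterated extensions of
standard ones. -/
lemma extAcyclic_induction (P : ObjectProperty C) (h0 : ∀ X, IsZero X → P X)
    (h : ∀ (l : Λ) (M : C) (g : M ⟶ H.std l) [Epi g], P (kernel g) → P M) {M : C}
    (hM : H.extAcyclic M) (h2 : ∀ l m, Subsingleton (Ext (H.std l) (H.costd m) 2)) : P M := by
  suffices ∀ (Y : Subobject M) (N : C) (i : N ⟶ M) [Mono i], Subobject.mk i = Y →
      H.extAcyclic N → P N from this _ M (𝟙 M) rfl hM
  have := H.isArtinian M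
  intro Y
  induction Y using WellFoundedLT.induction with
  | ind Y ih =>
  rintro N i _ rfl hN
  by_cases hz : IsZero N
  · exact h0 N hz
  obtain ⟨l, g, hg, hg0⟩ := H.exists_shortExact_std hN hz
  refine h l N g (ih (Subobject.mk (kernel.ι g ≫ i)) ?_ _ (kernel.ι g ≫ i) rfl ?_)
  · refine lt_of_le_of_ne (Subobject.mk_le_mk_of_comm (kernel.ι g) rfl) fun heq => hg0 ?_
    obtain ⟨e, he⟩ : ∃ e : N ⟶ kernel g, e ≫ kernel.ι g ≫ i = i :=
      ⟨Subobject.ofMkLEMk _ _ heq.ge, Subobject.ofMkLEMk_comp _⟩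
    rw [← Category.assoc] at he
    have : e ≫ kernel.ι g = 𝟙 N := by rw [← cancel_mono i, he, Category.id_comp]
    rw [← Category.id_comp g, ← this]; simp
  · exact fun m => ext_left_X₁ (shortExact_kernel g) (hN m) (h2 l m)

lemma ext_two_of_extAcyclic {M : C} (hM : H.extAcyclic M) (m : Λ) :
    Subsingleton (Ext M (H.costd m) 2) :=
  H.extAcyclic_induction (fun M => Subsingleton (Ext M (H.costd m) 2))
    (fun _ hX => ext_left_of_isZero hX)
    (fun l _ g _ hK => ext_left_X₂ (shortExact_kernel g) hK (H.ext_two l m)) hM H.ext_two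

/-- `P` behaves like a projective object with respect to the simple objects `L m`, `m ∈ Γ`. -/
structure IsRelProjective (Γ : Set Λ) (P : C) : Prop where
  extAcyclic : H.extAcyclic P
  ext_one : ∀ m ∈ Γ, Subsingleton (Ext P (H.L m) 1)

lemma finite_ext_one_simple {P : C} (hP : H.extAcyclic P) (l : Λ) :
    Module.Finite k (Ext P (H.L l) 1) := by
  have hS := shortExact_cokernel (H.incl l)
  have := H.finite_hom P (cokernel (H.incl l))
  have : Module.Finite k (Ext P (cokernel (H.incl l)) 0) := Module.Finite.equiv Ext.linearEquiv₀.symm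
  let φ : Ext P (cokernel (H.incl l)) 0 →ₗ[k] Ext P (H.L l) 1 :=
    { toFun x := x.comp hS.extClass (zero_add 1)
      map_add' := by simp
      map_smul' := by simp }
  refine Module.Finite.of_surjective φ fun x => ?_
  have := hP l
  exact Ext.covariant_sequence_exact₁ P hS x (Subsingleton.elim _ _) (zero_add 1)

/-- A universal extension argument. A nonzero class in `Ext¹(P, L_γ)` lifts to `Ext¹(P, Δ_γ)`,
because `Ext²(P, L_m) = 0` for `m < γ`. In the resulting extension `E` of `P` by `Δ_γ` the class
dies, and no new ones arise since `Ext¹(Δ_γ, L_γ) = 0`: the dimension drops. -/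
lemma exists_isRelProjective_step {Γ : Set Λ} {γ : Λ} (hγ : Set.Iio γ ⊆ Γ)
    (hmax : ∀ m ∈ Γ, ¬ γ < m) {X : C} (d : ℕ) :
    ∀ (P : C) (p : P ⟶ X), Epi p → H.IsRelProjective Γ P →
    Module.finrank k (Ext P (H.L γ) 1) = d →
    ∃ (P' : C) (p' : P' ⟶ X), Epi p' ∧ H.IsRelProjective (insert γ Γ) P' := by
  induction d using Nat.strong_induction_on with
  | _ d ih =>
  intro P p hp hP hd
  by_cases he : ∃ e : Ext P (H.L γ) 1, e ≠ 0
  · obtain ⟨e, he⟩ := he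
    have hQ (m : Λ) (hm : m < γ) : Subsingleton (Ext P (H.L m) 2) :=
      ext_right_X₁ (shortExact_cokernel (H.incl m))
        ((H.built_cokernel_incl m).ext_right fun n hn => hP.ext_one n (hγ (lt_trans hn hm)))
        (H.ext_two_of_extAcyclic hP.extAcyclic m)
    have hR : Subsingleton (Ext P (kernel (H.proj γ)) 2) := (H.built_kernel_proj γ).ext_right hQ
    obtain ⟨x, hx⟩ := Ext.covariant_sequence_exact₃ P (shortExact_kernel (H.proj γ)) e
      (n₁ := 2) rfl (Subsingleton.elim _ _)
    dsimp at x hx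
    obtain ⟨E, f, g, w, hS, rfl⟩ := exists_shortExact_extClass_eq x
    have hg : Epi g := hS.epi_g
    have hE : H.IsRelProjective Γ E :=
      { extAcyclic := H.extAcyclic_X₂ hS (H.extAcyclic_std γ) hP.extAcyclic
        ext_one m hm := ext_left_X₂ hS (H.ext_one_std_simple (hmax m hm)) (hP.ext_one m hm) }
    refine ih _ ?_ E (g ≫ p) inferInstance hE rfl
    have := H.finite_ext_one_simple hP.extAcyclic γ
    let φ := extLeftComp k g (H.L γ) 1
    have hφ : LinearMap.range φ = ⊤ := by
      rw [LinearMap.range_eq_top]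
      intro y
      have : Subsingleton (Ext (H.std γ) (H.L γ) 1) := H.ext_one_std_simple (lt_irrefl γ)
      exact Ext.contravariant_sequence_exact₂ hS _ y (Subsingleton.elim _ _)
    have hker : LinearMap.ker φ ≠ ⊥ := by
      rw [Submodule.ne_bot_iff]
      refine ⟨e, ?_, he⟩
      rw [LinearMap.mem_ker, ← hx]
      change (Ext.mk₀ g).comp (hS.extClass.comp (Ext.mk₀ (H.proj γ)) (add_zero 1)) (zero_add 1) = 0
      exact hS.comp_extClass_assoc _ _
    have h1 := LinearMap.finrank_range_add_finrank_ker φ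
    rw [hφ, finrank_top, hd] at h1
    have h2 : 0 < Module.finrank k (LinearMap.ker φ) :=
      Nat.pos_of_ne_zero fun h => hker (Submodule.finrank_eq_zero.1 h)
    lia
  · push Not at he
    refine ⟨P, p, hp, hP.extAcyclic, ?_⟩
    rintro m (rfl | hm)
    · exact subsingleton_of_forall_eq 0 he
    · exact hP.ext_one m hm

/-- Induction on `Γ` by removing a maximal `γ`. For `l = γ` the object `Δ_γ` already works;
otherwise the cover for `Γ \ {γ}` is corrected at `γ`. -/
lemma exists_isRelProjective_simple (n : ℕ) : ∀ (Γ : Set Λ), Γ.Finite → IsLowerSet Γ →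
    Γ.ncard = n → ∀ l ∈ Γ, ∃ (P : C) (p : P ⟶ H.L l), Epi p ∧ H.IsRelProjective Γ P := by
  induction n with
  | zero =>
    intro Γ hΓ _ hn l hl
    rw [Set.ncard_eq_zero hΓ] at hn
    simp [hn] at hl
  | succ n ih =>
    intro Γ hΓ hlow hn l hl
    obtain ⟨γ, hγ, hmax⟩ := hΓ.exists_maximal ⟨l, hl⟩
    have hmax' (m : Λ) (hm : m ∈ Γ) : ¬ γ < m := fun h => h.not_ge (hmax hm h.le)
    have hlow' : IsLowerSet (Γ \ {γ}) := by
      intro a b hab ha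
      refine ⟨hlow hab ha.1, ?_⟩
      rintro rfl
      exact hmax' a ha.1 (lt_of_le_of_ne hab fun h => ha.2 h.symm)
    have hins : insert γ (Γ \ {γ}) = Γ := by simp [Set.insert_eq_of_mem hγ]
    by_cases hlγ : l = γ
    · subst hlγ
      exact ⟨H.std l, H.proj l, inferInstance, H.extAcyclic_std l,
        fun m hm => H.ext_one_std_simple (hmax' m hm)⟩
    · obtain ⟨P, p, hp, hP⟩ := ih (Γ \ {γ}) (hΓ.subset Set.sdiff_subset) hlow'
        (by rw [Set.ncard_sdiff_singleton_of_mem hγ, hn]; rfl) l ⟨hl, hlγ⟩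
      rw [← hins]
      refine H.exists_isRelProjective_step ?_ (fun m hm => hmax' m hm.1) _ P p hp hP rfl
      exact fun m hm => ⟨hlow hm.le hγ, hm.ne⟩

lemma exists_isRelProjective {Γ : Set Λ} (hΓ : Γ.Finite) (hlow : IsLowerSet Γ) {X : C}
    (hX : Built H.L Γ X) : ∃ (P : C) (p : P ⟶ X), Epi p ∧ H.IsRelProjective Γ P := by
  induction hX with
  | @zero X hX =>
    exact ⟨X, 𝟙 X, inferInstance, fun m => ext_left_of_isZero hX, fun m _ => ext_left_of_isZero hX⟩
  | @ext X l hl g hg hK ih =>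
    obtain ⟨P, p, hp, hP⟩ := ih
    obtain ⟨P', p', hp', hP'⟩ := H.exists_isRelProjective_simple _ Γ hΓ hlow rfl l hl
    have hS := shortExact_kernel g
    -- As in the horseshoe lemma: this lifts `p'` to `X`, so that `P ⊞ P'` covers `X`.
    have : Subsingleton (Ext P' (kernel g) 1) := hK.ext_right hP'.ext_one
    obtain ⟨x, hx⟩ := Ext.covariant_sequence_exact₃ P' hS (Ext.mk₀ p') (zero_add 1)
      (Subsingleton.elim _ _)
    obtain ⟨x, rfl⟩ : ∃ x' : P' ⟶ X, Ext.mk₀ x' = x := (Ext.mk₀_bijective _ _).2 x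
    dsimp at hx
    rw [Ext.mk₀_comp_mk₀] at hx
    replace hx := (Ext.mk₀_bijective _ _).1 hx
    have hb := (ShortComplex.Splitting.ofHasBinaryBiproduct P P').shortExact
    refine ⟨P ⊞ P', biprod.desc (p ≫ kernel.ι g) x, ?_,
      H.extAcyclic_X₂ hb hP.extAcyclic hP'.extAcyclic,
      fun m hm => ext_left_X₂ hb (hP.ext_one m hm) (hP'.ext_one m hm)⟩
    refine Preadditive.epi_of_cancel_zero _ fun {Z} u hu => ?_
    have h1 : kernel.ι g ≫ u = 0 := by
      rw [← cancel_epi p]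
      simpa using biprod.inl ≫= hu
    have h2 : x ≫ u = 0 := by simpa using biprod.inr ≫= hu
    obtain ⟨v, hv⟩ : ∃ v : H.L l ⟶ Z, g ≫ v = u :=
      ⟨_, hS.gIsCokernel.fac (CokernelCofork.ofπ _ h1) WalkingParallelPair.one⟩
    have : v = 0 := by
      rw [← cancel_epi p', ← hx, Category.assoc, hv, h2, comp_zero]
    rw [← hv, this, comp_zero]

/-- Every object is a quotient of an object without first extensions by costandard objects. -/
lemma exists_epi_of_extAcyclic (X : C) : ∃ (P : C) (p : P ⟶ X), Epi p ∧ H.extAcyclic P := by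
  obtain ⟨F, hF, _, hX⟩ := (H.built_all X).exists_finite
  obtain ⟨P, p, hp, hP⟩ := H.exists_isRelProjective (Γ := ⋃ l ∈ F, Set.Iic l)
    (hF.biUnion fun l _ => H.finite_Iic l)
    (isLowerSet_iUnion₂ fun l _ => isLowerSet_Iic l)
    (hX.mono fun l hl => Set.mem_biUnion hl Set.self_mem_Iic)
  exact ⟨P, p, hp, hP.extAcyclic⟩

/-- Dimension shifting without projectives: an epimorphism from an acyclic `P` kills a given class
of degree `n + 2`, and its kernel is acyclic because `Ext²(M, ∇) = 0`. The class then comes from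
degree `n + 1` on the kernel. -/
lemma ext_costd_eq_zero (n : ℕ) (m : Λ) : ∀ {M : C}, H.extAcyclic M →
    Subsingleton (Ext M (H.costd m) (n + 1)) := by
  induction n with
  | zero => exact fun hM => hM m
  | succ n ih =>
    intro M hM
    refine subsingleton_of_forall_eq 0 fun x => ?_
    obtain ⟨X', p, hp, hx⟩ := exists_epi_mk₀_comp_eq_zero x
    obtain ⟨P, q, hq, hP⟩ := H.exists_epi_of_extAcyclic X'
    have hS := shortExact_kernel (q ≫ p)
    have hK : H.extAcyclic (kernel (q ≫ p)) := fun l =>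
      ext_left_X₁ hS (hP l) (H.ext_two_of_extAcyclic hM l)
    have hx' : (Ext.mk₀ (q ≫ p)).comp x (zero_add _) = 0 := by
      rw [← Ext.mk₀_comp_mk₀_assoc, hx, Ext.comp_zero]
    obtain ⟨y, rfl⟩ := Ext.contravariant_sequence_exact₃ hS _ x hx' (add_comm 1 (n + 1))
    have := ih hK
    rw [Subsingleton.elim y 0, Ext.comp_zero]

end HighestWeightCategory

/-- The objects `X` with `Ext X Y n = 0`. -/
def extLeftZero (Y : C) (n : ℕ) : ObjectProperty C := fun X => Subsingleton (Ext X Y n)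

/-- The objects `Y` with `Ext X Y n = 0`. -/
def extRightZero (X : C) (n : ℕ) : ObjectProperty C := fun Y => Subsingleton (Ext X Y n)

instance (Y : C) (n : ℕ) : (extLeftZero Y n).IsClosedUnderExtensions where
  prop_X₂_of_shortExact hS h₁ h₃ := ext_left_X₂ hS h₁ h₃

instance (Y : C) (n : ℕ) : (extLeftZero Y n).IsClosedUnderIsomorphisms where
  of_iso e h := ext_left_of_iso e.symm h

instance (X : C) (n : ℕ) : (extRightZero X n).IsClosedUnderExtensions where
  prop_X₂_of_shortExact hS h₁ h₃ := ext_right_X₂ hS h₁ h₃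

instance (X : C) (n : ℕ) : (extRightZero X n).IsClosedUnderIsomorphisms where
  of_iso e h := ext_right_of_iso e.symm h

/-- There are no higher extensions between tilting objects. -/
lemma HighestWeightCategory.ext_tilting_eq_zero (H : HighestWeightCategory C k Λ) {T T' : C}
    (hT : H.tilting T) (hT' : H.tilting T') (n : ℕ) : Subsingleton (Ext T T' (n + 1)) :=
  hT'.2.induction (extRightZero T (n + 1)) (fun _ hX => ext_right_of_isZero hX) fun m =>
    hT.1.induction (extLeftZero (H.costd m) (n + 1)) (fun _ hX => ext_left_of_isZero hX) fun l =>
      H.ext_costd_eq_zero n m (H.extAcyclic_std l)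

end ExtVanishing

end

section

/-! ### Bijectivity on morphisms is closed under extensions in triangles -/

section TriangulatedBijectivity

variable {A : Type*} {B : Type*} [Category A] [Category B]

/-- The functor `F` is bijective on the morphisms from `X` to `Y`. -/
def MapBij (F : A ⥤ B) (X Y : A) : Prop :=
  Function.Bijective (F.map : (X ⟶ Y) → (F.obj X ⟶ F.obj Y))

variable {F : A ⥤ B}

lemma MapBij.of_iso {X Y X' Y' : A} (h : MapBij F X Y) (e : X ≅ X') (e' : Y ≅ Y') :
    MapBij F X' Y' := by
  constructor
  · intro a b hab
    have := @h.1 (e.hom ≫ a ≫ e'.inv) (e.hom ≫ b ≫ e'.inv) (by simp [hab])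
    simpa using this
  · intro a
    obtain ⟨b, hb⟩ := h.2 (F.map e.hom ≫ a ≫ F.map e'.inv)
    refine ⟨e.inv ≫ b ≫ e'.hom, ?_⟩
    rw [F.map_comp, F.map_comp, hb]
    simp [← F.map_comp, ← F.map_comp_assoc]

lemma MapBij.eq_zero [HasZeroMorphisms A] [HasZeroMorphisms B] [F.PreservesZeroMorphisms]
    {X Y : A} (h : MapBij F X Y) {a : X ⟶ Y} (ha : F.map a = 0) : a = 0 :=
  h.1 (ha.trans (F.map_zero _ _).symm)

variable (F) in
/-- The functor `F` is bijective on the morphisms between all shifts of `X` and `Y`. -/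
def ShiftMapBij [HasShift A ℤ] (X Y : A) : Prop := ∀ m n : ℤ, MapBij F (X⟦m⟧) (Y⟦n⟧)

lemma ShiftMapBij.mapBij [HasShift A ℤ] {X Y : A} (h : ShiftMapBij F X Y) : MapBij F X Y :=
  (h 0 0).of_iso ((shiftFunctorZero A ℤ).app X) ((shiftFunctorZero A ℤ).app Y)

variable [HasZeroObject A] [HasZeroObject B]
  [Preadditive A] [Preadditive B] [HasShift A ℤ] [HasShift B ℤ]
  [∀ n : ℤ, (shiftFunctor A n).Additive] [∀ n : ℤ, (shiftFunctor B n).Additive]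
  [Pretriangulated A] [Pretriangulated B]
  [F.CommShift ℤ] [F.IsTriangulated]

lemma exists_map_comp_of_distinguished {T : Triangle A} (hT : T ∈ distTriang A) {Y : B}
    (g : F.obj T.obj₂ ⟶ Y) (hg : F.map T.mor₁ ≫ g = 0) :
    ∃ c : F.obj T.obj₃ ⟶ Y, g = F.map T.mor₂ ≫ c :=
  Triangle.yoneda_exact₂ _ (F.map_distinguished T hT) g hg

lemma exists_comp_map_of_distinguished {T : Triangle A} (hT : T ∈ distTriang A) {X : B}
    (g : X ⟶ F.obj T.obj₂) (hg : g ≫ F.map T.mor₂ = 0) :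
    ∃ c : X ⟶ F.obj T.obj₁, g = c ≫ F.map T.mor₁ :=
  Triangle.coyoneda_exact₂ _ (F.map_distinguished T hT) g hg

variable (F) in
lemma exists_connecting_of_distinguished {T : Triangle A} (hT : T ∈ distTriang A) :
    ∃ δ : T.obj₃⟦(-1 : ℤ)⟧ ⟶ T.obj₁, δ ≫ T.mor₁ = 0 ∧
      (∀ ⦃Y : A⦄ (a : T.obj₁ ⟶ Y), δ ≫ a = 0 → ∃ b : T.obj₂ ⟶ Y, a = T.mor₁ ≫ b) ∧
      ∀ ⦃X : B⦄ (g : X ⟶ F.obj T.obj₁), g ≫ F.map T.mor₁ = 0 →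
        ∃ c : X ⟶ F.obj (T.obj₃⟦(-1 : ℤ)⟧), g = c ≫ F.map δ :=
  have hinv := inv_rot_of_distTriang _ hT
  ⟨T.invRotate.mor₁, comp_distTriang_mor_zero₁₂ _ hinv,
    fun _ a ha => Triangle.yoneda_exact₂ _ hinv a ha,
    fun _ g hg => exists_comp_map_of_distinguished hinv g hg⟩

variable [F.Additive]

/-- The five lemma as a diagram chase: `T.obj₁⟦1⟧` enters in the injectivity, `T.obj₃⟦-1⟧` in the
surjectivity. -/
lemma MapBij.left_of_distinguished {T : Triangle A} (hT : T ∈ distTriang A) {Y : A}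
    (h₁ : MapBij F T.obj₁ Y) (h₃ : MapBij F T.obj₃ Y) (h₁' : MapBij F (T.obj₁⟦(1 : ℤ)⟧) Y)
    (h₃' : MapBij F (T.obj₃⟦(-1 : ℤ)⟧) Y) : MapBij F T.obj₂ Y := by
  obtain ⟨δ, hδ, hδ₁, hδ₂⟩ := exists_connecting_of_distinguished F hT
  have hrot := rot_of_distTriang _ hT
  constructor
  · refine (injective_iff_map_eq_zero (F.mapAddHom (X := T.obj₂) (Y := Y))).2 fun h hh => ?_
    change F.map h = 0 at hh
    obtain ⟨c, rfl⟩ := Triangle.yoneda_exact₂ T hT h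
      (h₁.eq_zero (by rw [F.map_comp, hh, comp_zero]))
    rw [F.map_comp] at hh
    obtain ⟨d, hd⟩ := exists_map_comp_of_distinguished hrot (F.map c) hh
    obtain ⟨d, rfl⟩ := h₁'.2 d
    have hc : c = T.mor₃ ≫ d := h₃.1 (by rw [F.map_comp]; exact hd)
    rw [hc, comp_distTriang_mor_zero₂₃_assoc _ hT, zero_comp]
  · intro g
    obtain ⟨a, ha⟩ := h₁.2 (F.map T.mor₁ ≫ g)
    obtain ⟨b, hb⟩ := hδ₁ a (h₃'.eq_zero (by
      rw [F.map_comp, ha, ← F.map_comp_assoc, hδ, F.map_zero, zero_comp]))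
    obtain ⟨c, hc⟩ := exists_map_comp_of_distinguished hT (g - F.map b) (by
      rw [Preadditive.comp_sub, ← ha, ← F.map_comp, hb, sub_self])
    obtain ⟨c, rfl⟩ := h₃.2 c
    exact ⟨b + T.mor₂ ≫ c, by rw [F.map_add, F.map_comp, ← hc]; abel⟩

lemma MapBij.right_of_distinguished {T : Triangle A} (hT : T ∈ distTriang A) {X : A}
    (h₁ : MapBij F X T.obj₁) (h₃ : MapBij F X T.obj₃) (h₁' : MapBij F X (T.obj₁⟦(1 : ℤ)⟧))
    (h₃' : MapBij F X (T.obj₃⟦(-1 : ℤ)⟧)) : MapBij F X T.obj₂ := by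
  obtain ⟨δ, hδ, hδ₁, hδ₂⟩ := exists_connecting_of_distinguished F hT
  constructor
  · refine (injective_iff_map_eq_zero (F.mapAddHom (X := X) (Y := T.obj₂))).2 fun h hh => ?_
    change F.map h = 0 at hh
    obtain ⟨c, rfl⟩ := Triangle.coyoneda_exact₂ T hT h
      (h₃.eq_zero (by rw [F.map_comp, hh, zero_comp]))
    rw [F.map_comp] at hh
    obtain ⟨d, hd⟩ := hδ₂ (F.map c) hh
    obtain ⟨d, rfl⟩ := h₃'.2 d
    have hc : c = d ≫ δ := h₁.1 (by rw [F.map_comp]; exact hd)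
    rw [hc, Category.assoc, hδ, comp_zero]
  · intro g
    obtain ⟨a, ha⟩ := h₃.2 (g ≫ F.map T.mor₂)
    obtain ⟨b, hb⟩ := Triangle.coyoneda_exact₃ _ hT a (h₁'.eq_zero (by
      rw [F.map_comp, ha, Category.assoc, ← F.map_comp, comp_distTriang_mor_zero₂₃ _ hT,
        F.map_zero, comp_zero]))
    obtain ⟨c, hc⟩ := exists_comp_map_of_distinguished hT (g - F.map b) (by
      rw [Preadditive.sub_comp, ← ha, ← F.map_comp, hb, sub_self])
    obtain ⟨c, rfl⟩ := h₁.2 c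
    exact ⟨b + c ≫ T.mor₁, by rw [F.map_add, F.map_comp, ← hc]; abel⟩

/-- Quantifying over all shifts supplies the two shifted hypotheses of the five lemma. -/
lemma ShiftMapBij.left_of_distinguished {T : Triangle A} (hT : T ∈ distTriang A) {Y : A}
    (h₁ : ShiftMapBij F T.obj₁ Y) (h₃ : ShiftMapBij F T.obj₃ Y) : ShiftMapBij F T.obj₂ Y :=
  fun m n => MapBij.left_of_distinguished (T.shift_distinguished hT m) (h₁ m n) (h₃ m n)
    ((h₁ (m + 1) n).of_iso ((shiftFunctorAdd A m 1).app _) (Iso.refl _))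
    ((h₃ (m + -1) n).of_iso ((shiftFunctorAdd A m (-1)).app _) (Iso.refl _))

lemma ShiftMapBij.right_of_distinguished {T : Triangle A} (hT : T ∈ distTriang A) {X : A}
    (h₁ : ShiftMapBij F X T.obj₁) (h₃ : ShiftMapBij F X T.obj₃) : ShiftMapBij F X T.obj₂ :=
  fun m n => MapBij.right_of_distinguished (T.shift_distinguished hT n) (h₁ m n) (h₃ m n)
    ((h₁ m (n + 1)).of_iso (Iso.refl _) ((shiftFunctorAdd A n 1).app _))
    ((h₃ m (n + -1)).of_iso (Iso.refl _) ((shiftFunctorAdd A n (-1)).app _))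

end TriangulatedBijectivity

/-! ### Dévissage of bounded complexes in the homotopy category -/

section Devissage

open HomologicalComplex

variable {C : Type u} [Category.{v} C] [Abelian C]

/-- The projection of a complex concentrated in degrees `≥ a` onto its term of degree `a`. -/
def toSingleLowest (K : CochainComplex C ℤ) (a : ℤ) (hK : ∀ i < a, IsZero (K.X i)) :
    K ⟶ (single C (ComplexShape.up ℤ) a).obj (K.X a) :=
  mkHomToSingle (𝟙 _) (fun i hi => (hK i (by have : i + 1 = a := hi; lia)).eq_of_src _ _)

instance (K : CochainComplex C ℤ) (a : ℤ) (hK : ∀ i < a, IsZero (K.X i)) :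
    IsIso ((toSingleLowest K a hK).f a) := by
  dsimp only [toSingleLowest]
  rw [mkHomToSingle_f]
  infer_instance

/-- A morphism to a single complex that is an isomorphism in the relevant degree is degreewise a
split epimorphism. -/
def sectionOfIsIso {K : CochainComplex C ℤ} {a : ℤ} {X : C}
    (π : K ⟶ (single C (ComplexShape.up ℤ) a).obj X) [IsIso (π.f a)] (i : ℤ) :
    ((single C (ComplexShape.up ℤ) a).obj X).X i ⟶ K.X i :=
  if h : i = a then (XIsoOfEq _ h).hom ≫ inv (π.f a) ≫ (XIsoOfEq _ h.symm).hom else 0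

lemma sectionOfIsIso_comp {K : CochainComplex C ℤ} {a : ℤ} {X : C}
    (π : K ⟶ (single C (ComplexShape.up ℤ) a).obj X) [IsIso (π.f a)] (i : ℤ) :
    sectionOfIsIso π i ≫ π.f i = 𝟙 _ := by
  by_cases h : i = a
  · subst h
    simp [sectionOfIsIso]
  · exact (isZero_single_obj_X _ _ _ _ h).eq_of_src _ _

/-- Dévissage of bounded complexes: a property of objects of the homotopy category that is closed
under extensions holds for a bounded complex if it holds for its terms. -/
lemma devissage_homotopyCategory (S : ObjectProperty C) [S.IsClosedUnderIsomorphisms]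
    (hS : ∀ X, IsZero X → S X)
    (P : ObjectProperty (HomotopyCategory C (ComplexShape.up ℤ)))
    (hP : ∀ X, IsZero X → P X)
    (hP' : ∀ T ∈ distTriang (HomotopyCategory C (ComplexShape.up ℤ)),
      P T.obj₁ → P T.obj₃ → P T.obj₂)
    (h : ∀ (a : ℤ) (X : C), S X → P ((HomotopyCategory.singleFunctor C a).obj X))
    (n : ℕ) : ∀ (K : CochainComplex C ℤ) (a : ℤ), (∀ i, i < a ∨ a + n ≤ i → IsZero (K.X i)) →
      (∀ i, S (K.X i)) → P ((HomotopyCategory.quotient C (ComplexShape.up ℤ)).obj K) := by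
  induction n with
  | zero =>
    intro K a hK _
    refine hP _ ((HomotopyCategory.quotient C (ComplexShape.up ℤ)).map_isZero ?_)
    rw [IsZero.iff_id_eq_zero]
    ext i
    exact (hK i (by lia)).eq_of_src _ _
  | succ n ih =>
    intro K a hK hKS
    have hK' : ∀ i < a, IsZero (K.X i) := fun i hi => hK i (Or.inl hi)
    -- The projection to the lowest term is degreewise split, so it gives a triangle with its
    -- kernel, whose range of degrees is shorter by one.
    let π := toSingleLowest K a hK'
    have hsec (i : ℤ) : sectionOfIsIso π i ≫ π.f i = 𝟙 _ := sectionOfIsIso_comp π i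
    have hepi (i : ℤ) : Epi (π.f i) := epi_of_epi_fac (hsec i)
    have : Epi π := HomologicalComplex.epi_of_epi_f π hepi
    have hSE := shortExact_kernel π
    have hSE' (i : ℤ) := hSE.map_of_exact (HomologicalComplex.eval C (ComplexShape.up ℤ) i)
    have hmono (i : ℤ) : Mono ((kernel.ι π).f i) := (hSE' i).mono_f
    let σ (i : ℤ) := ShortComplex.Splitting.ofExactOfSection _ (hSE' i).exact
      (sectionOfIsIso π i) (hsec i) (hmono i)
    have hw (i : ℤ) : (kernel.ι π).f i ≫ π.f i = 0 := by
      rw [← HomologicalComplex.comp_f, kernel.condition]; rfl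
    have hz : IsZero ((kernel π).X a) := by
      refine IsZero.of_mono_eq_zero ((kernel.ι π).f a) ?_
      rw [← cancel_mono (π.f a), hw, zero_comp]
    have hiso (i : ℤ) (hi : i ≠ a) : IsIso ((kernel.ι π).f i) := by
      have : Epi ((kernel.ι π).f i) :=
        (hSE' i).exact.epi_f
          ((isZero_single_obj_X (ComplexShape.up ℤ) a (K.X a) i hi).eq_of_tgt _ _)
      exact isIso_of_mono_of_epi _
    have hP₁ : P ((HomotopyCategory.quotient C (ComplexShape.up ℤ)).obj (kernel π)) := by
      refine ih _ (a + 1) (fun i hi => ?_) (fun i => ?_)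
      · by_cases hia : i = a
        · subst hia; exact hz
        · exact (hK i (by push_cast; lia)).of_mono ((kernel.ι π).f i)
      · by_cases hia : i = a
        · subst hia; exact hS _ hz
        · have := hiso i hia
          exact S.prop_of_iso (asIso ((kernel.ι π).f i)).symm (hKS i)
    exact hP' (CochainComplex.trianglehOfDegreewiseSplit _ σ)
      ((HomotopyCategory.distinguished_iff_iso_trianglehOfDegreewiseSplit _).2
        ⟨_, σ, ⟨Iso.refl _⟩⟩) hP₁ (h a _ (hKS a))

end Devissage

/-! ### Homotopy classes compute morphisms in the derived category -/

section FullyFaithful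

open Abelian DerivedCategory

variable {C : Type u} [Category.{v} C] [Abelian C] [HasDerivedCategory.{t'} C] [HasExt.{t} C]

/-- For `a < b` this is the t-structure axiom; for `a > b` the group is `Ext^{a-b}(X, Y)`, with `a -
b = d + 1`. -/
lemma hom_singleFunctor_eq_zero {X Y : C} (h : ∀ n, Subsingleton (Ext X Y (n + 1))) {a b : ℤ}
    (hab : a ≠ b) (f : (singleFunctor C a).obj X ⟶ (singleFunctor C b).obj Y) : f = 0 := by
  by_cases hlt : a < b
  · exact TStructure.t.zero_of_isLE_of_isGE f a b hlt inferInstance inferInstance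
  · obtain ⟨d, rfl⟩ := Int.le.dest (show b + 1 ≤ a by lia)
    apply (shiftFunctor (DerivedCategory C) (b + 1 + d)).map_injective
    let e₁ := ((singleFunctors C).shiftIso (b + 1 + d) 0 (b + 1 + d) (by lia)).app X
    let e₂ := ((singleFunctors C).shiftIso (b + 1 + d) (-(d + 1)) b (by lia)).app Y
    let e₃ := ((singleFunctors C).shiftIso ((d + 1 : ℕ) : ℤ) (-(d + 1)) 0
      (by push_cast; lia)).app Y
    have := h d
    have h0 : e₁.inv ≫ f⟦b + 1 + (d : ℤ)⟧' ≫ e₂.hom ≫ e₃.inv = 0 :=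
      (Ext.homEquiv (X := X) (Y := Y) (n := d + 1)).symm.injective (Subsingleton.elim _ _)
    rw [← cancel_epi e₁.inv, ← cancel_mono (e₂.hom ≫ e₃.inv), Category.assoc, h0]
    simp

lemma mapBij_singleFunctor {X Y : C} (h : ∀ n, Subsingleton (Ext X Y (n + 1))) (a b : ℤ) :
    MapBij Qh ((HomotopyCategory.singleFunctor C a).obj X)
      ((HomotopyCategory.singleFunctor C b).obj Y) := by
  have hq (f : (HomotopyCategory.singleFunctor C a).obj X ⟶
      (HomotopyCategory.singleFunctor C b).obj Y) :
      ∃ f' : (CochainComplex.singleFunctor C a).obj X ⟶ (CochainComplex.singleFunctor C b).obj Y,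
        (HomotopyCategory.quotient C (ComplexShape.up ℤ)).map f' = f :=
    (HomotopyCategory.quotient C (ComplexShape.up ℤ)).map_surjective f
  by_cases hab : a = b
  · subst hab
    constructor
    · intro f g hfg
      obtain ⟨f, rfl⟩ := hq f
      obtain ⟨g, rfl⟩ := hq g
      obtain ⟨f, rfl⟩ := (CochainComplex.singleFunctor C a).map_surjective f
      obtain ⟨g, rfl⟩ := (CochainComplex.singleFunctor C a).map_surjective g
      have : f = g := (DerivedCategory.singleFunctor C a).map_injective hfg
      rw [this]
    · intro f
      obtain ⟨g, hg⟩ := (DerivedCategory.singleFunctor C a).map_surjective f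
      exact ⟨(HomotopyCategory.singleFunctor C a).map g, hg⟩
  · constructor
    · intro f g _
      obtain ⟨f, rfl⟩ := hq f
      obtain ⟨g, rfl⟩ := hq g
      congr 1
      apply HomologicalComplex.from_single_hom_ext
      exact (HomologicalComplex.isZero_single_obj_X _ _ _ _ hab).eq_of_tgt _ _
    · intro f
      exact ⟨0, (Functor.map_zero _ _ _).trans (hom_singleFunctor_eq_zero h hab f).symm⟩

lemma shiftMapBij_singleFunctor {X Y : C} (h : ∀ n, Subsingleton (Ext X Y (n + 1))) (a b : ℤ) :
    ShiftMapBij Qh ((HomotopyCategory.singleFunctor C a).obj X)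
      ((HomotopyCategory.singleFunctor C b).obj Y) :=
  fun m n => (mapBij_singleFunctor h (a - m) (b - n)).of_iso
    (((HomotopyCategory.singleFunctors C).shiftIso m (a - m) a (by lia)).app X).symm
    (((HomotopyCategory.singleFunctors C).shiftIso n (b - n) b (by lia)).app Y).symm

lemma mapBij_of_isZero_left {A B : Type*} [Category A] [Category B] [HasZeroMorphisms A]
    [HasZeroMorphisms B] {F : A ⥤ B} [F.PreservesZeroMorphisms] {X Y : A} (hX : IsZero X) :
    MapBij F X Y :=
  ⟨fun _ _ _ => hX.eq_of_src _ _, fun _ => ⟨0, (F.map_isZero hX).eq_of_src _ _⟩⟩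

lemma mapBij_of_isZero_right {A B : Type*} [Category A] [Category B] [HasZeroMorphisms A]
    [HasZeroMorphisms B] {F : A ⥤ B} [F.PreservesZeroMorphisms] {X Y : A} (hY : IsZero Y) :
    MapBij F X Y :=
  ⟨fun _ _ _ => hY.eq_of_tgt _ _, fun _ => ⟨0, (F.map_isZero hY).eq_of_tgt _ _⟩⟩

/-- Morphisms in the derived category between bounded complexes without higher extensions between
their terms are homotopy classes of morphisms of complexes. -/
lemma mapBij_Qh_of_ext {K M : CochainComplex C ℤ} (hK : IsBoundedComplex K)
    (hM : IsBoundedComplex M) (h : ∀ i j n, Subsingleton (Ext (K.X i) (M.X j) (n + 1))) :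
    MapBij Qh ((HomotopyCategory.quotient C (ComplexShape.up ℤ)).obj K)
      ((HomotopyCategory.quotient C (ComplexShape.up ℤ)).obj M) := by
  obtain ⟨a, b, hK⟩ := hK
  obtain ⟨a', b', hM⟩ := hM
  refine ShiftMapBij.mapBij (F := Qh) ?_
  -- Two nested dévissages: first `K` is reduced to single objects with `M` fixed, then `M`. The
  -- predicate `S` keeps the vanishing against all terms of `M` for the second round.
  let S : ObjectProperty C := fun X => ∀ j n, Subsingleton (Ext X (M.X j) (n + 1))
  have : S.IsClosedUnderIsomorphisms := ⟨fun e h j n => ext_left_of_iso e.symm (h j n)⟩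
  refine devissage_homotopyCategory S (fun X hX j n => ext_left_of_isZero hX)
    (fun X => ShiftMapBij Qh X ((HomotopyCategory.quotient C (ComplexShape.up ℤ)).obj M))
    (fun X hX m n => mapBij_of_isZero_left ((shiftFunctor _ m).map_isZero hX))
    (fun T hT => ShiftMapBij.left_of_distinguished hT) ?_ (b + 1 - a).toNat K a
    (fun i hi => hK i (by lia)) (fun i j n => h i j n)
  intro c X hX
  let S' : ObjectProperty C := fun Y => ∀ n, Subsingleton (Ext X Y (n + 1))
  have : S'.IsClosedUnderIsomorphisms := ⟨fun e h n => ext_right_of_iso e.symm (h n)⟩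
  refine devissage_homotopyCategory S' (fun X hX n => ext_right_of_isZero hX)
    (fun Y => ShiftMapBij Qh ((HomotopyCategory.singleFunctor C c).obj X) Y)
    (fun Y hY m n => mapBij_of_isZero_right ((shiftFunctor _ n).map_isZero hY))
    (fun T hT => ShiftMapBij.right_of_distinguished hT) ?_ (b' + 1 - a').toNat M a'
    (fun i hi => hM i (by lia)) (fun j n => hX j n)
  intro d Y hY
  exact shiftMapBij_singleFunctor hY c d

end FullyFaithful

end

section

/-! ### Krull–Schmidt multiplicities as dimensions modulo the radical -/

section KrullSchmidt

attribute [local instance] Abelian.hasFiniteBiproducts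

/-- Fitting's lemma: factoring the minimal polynomial of `a` as `X ^ n * q` with `q` prime to `X`
yields an idempotent polynomial in `a`; the value 0 makes `a` nilpotent, the value 1 makes it
invertible. -/
lemma isUnit_or_isNilpotent_of_idempotents {k R : Type*} [Field k] [Ring R] [Algebra k R]
    [Module.Finite k R] (h : ∀ e : R, e * e = e → e = 0 ∨ e = 1) (a : R) :
    IsUnit a ∨ IsNilpotent a := by
  open Polynomial in
  have hint : IsIntegral k a := Algebra.IsIntegral.isIntegral a
  obtain ⟨q, hq, hX⟩ := exists_eq_pow_rootMultiplicity_mul_and_not_dvd (minpoly k a)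
    (minpoly.ne_zero hint) 0
  set n := (minpoly k a).rootMultiplicity 0
  rw [C_0, sub_zero] at hq hX
  -- The exponent `n + 1` rather than `n` guarantees a factor `X`, which provides the inverse of `a`
  -- even when `n = 0`.
  have hcop : IsCoprime (X ^ (n + 1)) q :=
    ((irreducible_X.coprime_iff_not_dvd).2 hX).pow_left
  obtain ⟨u, v, huv⟩ := hcop
  have h0 : aeval a (X ^ (n + 1) * q) = 0 := by
    have : X ^ (n + 1) * q = X * minpoly k a := by rw [hq]; ring
    rw [this, map_mul, minpoly.aeval, mul_zero]
  have he : aeval a (u * X ^ (n + 1)) * aeval a (u * X ^ (n + 1)) =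
      aeval a (u * X ^ (n + 1)) := by
    have : u * X ^ (n + 1) * (u * X ^ (n + 1)) =
        u * X ^ (n + 1) - u * v * (X ^ (n + 1) * q) := by
      have : v * q = 1 - u * X ^ (n + 1) := by rw [← huv]; ring
      linear_combination (u * X ^ (n + 1)) * this
    rw [← map_mul, this, map_sub, map_mul (aeval a) (u * v), h0, mul_zero, sub_zero]
  rcases h _ he with h | h
  · right
    refine ⟨n + 1, ?_⟩
    have hv : aeval a (v * q) = 1 := by
      have := congrArg (aeval a) huv
      rwa [map_add, h, zero_add, map_one] at this
    have : aeval a (v * (X ^ (n + 1) * q)) = a ^ (n + 1) := by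
      rw [show v * (X ^ (n + 1) * q) = X ^ (n + 1) * (v * q) by ring,
        map_mul (aeval a) (X ^ (n + 1)), hv, mul_one, map_pow, aeval_X]
    rw [← this, map_mul (aeval a) v, h0, mul_zero]
  · left
    refine ⟨⟨a, aeval a (u * X ^ n), ?_, ?_⟩, rfl⟩
    · rw [← h, show u * X ^ (n + 1) = X * (u * X ^ n) by ring,
        map_mul (aeval a) X, aeval_X]
    · rw [← h, show u * X ^ (n + 1) = u * X ^ n * X by ring,
        map_mul (aeval a) (u * X ^ n), aeval_X]

variable {C : Type u} [Category.{v} C] [Abelian C]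

/-- A retract is a direct summand. -/
def isoBiprodOfRetract {X Y : C} (i : X ⟶ Y) (r : Y ⟶ X) (h : i ≫ r = 𝟙 X) :
    Y ≅ kernel r ⊞ X :=
  haveI : Epi r := epi_of_epi_fac h
  (ShortComplex.Splitting.ofExactOfSection
    (ShortComplex.mk (kernel.ι r) r (kernel.condition r)) (ShortComplex.exact_kernel r) i h
    inferInstance).isoBinaryBiproduct

lemma isDirectSummand_of_retract {X Y : C} (i : X ⟶ Y) (r : Y ⟶ X) (h : i ≫ r = 𝟙 X) :
    IsDirectSummand X Y :=
  ⟨kernel r, ⟨(biprod.braiding _ _) ≪≫ (isoBiprodOfRetract i r h).symm⟩⟩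

lemma isIso_of_retract_indecomposable {X Y : C} (hY : Indecomposable Y) (hX : ¬ IsZero X)
    (i : X ⟶ Y) (r : Y ⟶ X) (h : i ≫ r = 𝟙 X) : IsIso r := by
  rcases hY.2 _ _ (isoBiprodOfRetract i r h) with h0 | h0
  · have : Mono r := Preadditive.mono_of_isZero_kernel r h0
    have : Epi r := epi_of_epi_fac h
    exact isIso_of_mono_of_epi r
  · exact (hX h0).elim

lemma eq_zero_or_one_of_indecomposable {X : C} (hX : Indecomposable X) (e : End X)
    (he : e * e = e) :
    e = 0 ∨ e = 1 := by
  obtain ⟨Y, i, r, hir, hri⟩ := IsIdempotentComplete.idempotents_split X e he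
  by_cases hY : IsZero Y
  · left
    rw [← hri, hY.eq_of_tgt r 0, zero_comp]
  · right
    have := isIso_of_retract_indecomposable hX hY i r hir
    have hi : i = inv r := IsIso.eq_inv_of_inv_hom_id hir
    rw [← hri, hi, IsIso.hom_inv_id]
    rfl

variable {k : Type w} [Field k] [Linear k C]

section Local

variable {T : C} [Module.Finite k (End T)] (hT : Indecomposable T)

lemma isIso_or_isIso_of_isIso_add (k : Type w) [Field k] [Linear k C] {T : C}
    [Module.Finite k (End T)] (hT : Indecomposable T) {f g : T ⟶ T}
    (h : IsIso (f + g)) : IsIso f ∨ IsIso g := by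
  rw [← isUnit_iff_isIso (X := T)] at h ⊢
  rw [← isUnit_iff_isIso (X := T) g]
  let a : End T := f
  let b : End T := g
  change IsUnit (a + b) at h
  change IsUnit a ∨ IsUnit b
  obtain ⟨s, hs⟩ := h
  have h1 : s⁻¹.1 * a + s⁻¹.1 * b = 1 := by rw [← mul_add, ← hs, Units.inv_mul]
  rcases isUnit_or_isNilpotent_of_idempotents (k := k)
    (eq_zero_or_one_of_indecomposable hT) (s⁻¹.1 * a) with h | h
  · left
    rwa [Units.isUnit_units_mul] at h
  · right
    have := h.isUnit_one_sub
    rwa [← h1, add_sub_cancel_left, Units.isUnit_units_mul] at this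

lemma exists_isIso_of_isIso_sum (k : Type w) [Field k] [Linear k C] {T : C}
    [Module.Finite k (End T)] (hT : Indecomposable T) {J : Type*} (s : Finset J)
    (f : J → (T ⟶ T)) (h : IsIso (∑ j ∈ s, f j)) : ∃ j ∈ s, IsIso (f j) := by
  classical
  induction s using Finset.induction_on with
  | empty =>
    rw [Finset.sum_empty] at h
    exact (hT.1 (IsZero.of_mono_zero T T)).elim
  | insert a s ha ih =>
    rw [Finset.sum_insert ha] at h
    rcases isIso_or_isIso_of_isIso_add k hT h with h | h
    · exact ⟨a, Finset.mem_insert_self _ _, h⟩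
    · obtain ⟨j, hj, h⟩ := ih h
      exact ⟨j, Finset.mem_insert_of_mem hj, h⟩

variable (k) in
/-- The morphisms from an indecomposable object that are not split monomorphisms. -/
def radHom (hT : Indecomposable T) (M : C) : Submodule k (T ⟶ M) where
  carrier := {f | ∀ g : M ⟶ T, ¬ IsIso (f ≫ g)}
  add_mem' {a b} ha hb g hg := by
    rw [Preadditive.add_comp] at hg
    rcases isIso_or_isIso_of_isIso_add k hT hg with h | h
    · exact ha g h
    · exact hb g h
  zero_mem' g hg := by
    rw [zero_comp] at hg
    exact hT.1 (IsZero.of_mono_zero T T)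
  smul_mem' c f hf g hg := by
    refine hf (c • g) ?_
    rwa [Linear.comp_smul, ← Linear.smul_comp]

variable (k) in
/-- The dimension of the space of morphisms from `T` to `M` modulo the radical. -/
def radRank (hT : Indecomposable T) (M : C) : ℕ :=
  Module.finrank k ((T ⟶ M) ⧸ radHom k hT M)

lemma radRank_bicone {J : Type} [Fintype J] [DecidableEq J] {N : J → C} (b : Bicone N)
    (hb : b.IsBilimit) [∀ X : C, Module.Finite k (T ⟶ X)] :
    radRank k hT b.pt = ∑ j, radRank k hT (N j) := by
  have htot (f : T ⟶ b.pt) : ∑ j, (f ≫ b.π j) ≫ b.ι j = f := by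
    simp_rw [Category.assoc]
    rw [← Preadditive.comp_sum, IsBilimit.total hb, Category.comp_id]
  let e : (T ⟶ b.pt) ≃ₗ[k] (∀ j, T ⟶ N j) :=
    { toFun f j := f ≫ b.π j
      map_add' f g := by ext; simp
      map_smul' c f := by ext; simp
      invFun f := ∑ j, f j ≫ b.ι j
      left_inv f := htot f
      right_inv f := by
        ext j
        simp only [Preadditive.sum_comp, Category.assoc, b.ι_π]
        rw [Finset.sum_eq_single j]
        · simp
        · intro i _ hij
          simp [hij]
        · simp }
  have he : (radHom k hT b.pt).map e.toLinearMap =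
      Submodule.pi Set.univ fun j => radHom k hT (N j) := by
    ext f
    constructor
    · rintro ⟨f, hf, rfl⟩ j _ g hg
      refine hf (b.π j ≫ g) ?_
      rw [← Category.assoc]
      exact hg
    · intro hf
      refine ⟨e.symm f, fun g hg => ?_, e.apply_symm_apply f⟩
      change IsIso ((∑ j, f j ≫ b.ι j) ≫ g) at hg
      rw [Preadditive.sum_comp] at hg
      obtain ⟨j, _, hj⟩ := exists_isIso_of_isIso_sum k hT _ _ hg
      rw [Category.assoc] at hj
      exact hf j (Set.mem_univ j) _ hj
  unfold radRank
  rw [LinearEquiv.finrank_eq (Submodule.Quotient.equiv _ _ e he),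
    LinearEquiv.finrank_eq (Submodule.quotientPi _), Module.finrank_pi_fintype]

lemma radRank_biprod (X Y : C) [∀ X : C, Module.Finite k (T ⟶ X)] :
    radRank k hT (X ⊞ Y) = radRank k hT X + radRank k hT Y := by
  have := radRank_bicone (k := k) hT (BinaryBiproduct.bicone X Y).toBicone
    ((BinaryBicone.toBiconeIsBilimit _).symm (BinaryBiproduct.isBilimit X Y))
  rw [← Equiv.sum_comp WalkingPair.equivBool.symm, Fintype.sum_bool] at this
  exact this

lemma radRank_iso {M N : C} (e : M ≅ N) : radRank k hT M = radRank k hT N := by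
  let φ : (T ⟶ M) ≃ₗ[k] (T ⟶ N) :=
    { toFun f := f ≫ e.hom
      map_add' f g := by simp
      map_smul' c f := by simp
      invFun f := f ≫ e.inv
      left_inv f := by simp
      right_inv f := by simp }
  refine LinearEquiv.finrank_eq (Submodule.Quotient.equiv _ _ φ ?_)
  ext f
  constructor
  · rintro ⟨f, hf, rfl⟩ g hg
    refine hf (e.hom ≫ g) ?_
    rw [← Category.assoc]
    exact hg
  · intro hf
    refine ⟨f ≫ e.inv, fun g hg => hf (e.inv ≫ g) ?_, φ.apply_symm_apply f⟩
    rwa [← Category.assoc]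

/-- Positivity suffices to cancel this factor later; `End T` modulo its radical need not be `k`. -/
lemma radRank_self_pos : 0 < radRank k hT T := by
  have h : Nontrivial ((T ⟶ T) ⧸ radHom k hT T) := by
    rw [Submodule.Quotient.nontrivial_iff]
    intro h
    have : 𝟙 T ∈ radHom k hT T := h ▸ Submodule.mem_top
    exact this (𝟙 T) (by rw [Category.comp_id]; infer_instance)
  have : Module.Finite k (T ⟶ T) := inferInstanceAs (Module.Finite k (End T))
  exact Module.finrank_pos

lemma radRank_eq_zero {N : C} (hN : Indecomposable N) (h : ¬ Nonempty (N ≅ T)) :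
    radRank k hT N = 0 := by
  have : radHom k hT N = ⊤ := by
    rw [eq_top_iff]
    intro f _ g hg
    have := isIso_of_retract_indecomposable hN hT.1 f (g ≫ inv (f ≫ g))
      (by rw [← Category.assoc, IsIso.hom_inv_id])
    exact h ⟨asIso (g ≫ inv (f ≫ g))⟩
  unfold radRank
  rw [this]
  exact Module.finrank_zero_of_subsingleton

lemma radRank_eq_card_mul [∀ X : C, Module.Finite k (T ⟶ X)] {M : C} {n : ℕ} {f : Fin n → C}
    (h : IsKrullSchmidtDecomposition M f) :
    radRank k hT M = Nat.card {i // Nonempty (f i ≅ T)} * radRank k hT T := by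
  classical
  obtain ⟨hf, ⟨e⟩⟩ := h
  rw [radRank_iso hT e]
  refine (radRank_bicone hT (biproduct.bicone f) (biproduct.isBilimit f)).trans ?_
  rw [Nat.card_eq_fintype_card, Fintype.card_subtype, Finset.card_filter, Finset.sum_mul]
  refine Finset.sum_congr rfl fun i _ => ?_
  split_ifs with h
  · rw [one_mul, radRank_iso hT h.some]
  · rw [zero_mul, radRank_eq_zero hT (hf i) h]

end Local

/-- A biproduct over a disjoint union. -/
def biproductSumIso {J J' : Type} [Finite J] [Finite J'] (f : J ⊕ J' → C) :
    (⨁ fun j => f (Sum.inl j)) ⊞ (⨁ fun j => f (Sum.inr j)) ≅ ⨁ f where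
  hom := biprod.desc (biproduct.desc fun j => biproduct.ι f (Sum.inl j))
    (biproduct.desc fun j => biproduct.ι f (Sum.inr j))
  inv := biproduct.desc (Sum.rec
    (fun j => biproduct.ι (fun j => f (Sum.inl j)) j ≫ biprod.inl)
    (fun j => biproduct.ι (fun j => f (Sum.inr j)) j ≫ biprod.inr))
  hom_inv_id := by
    apply biprod.hom_ext'
    · rw [biprod.inl_desc_assoc, Category.comp_id]
      exact biproduct.hom_ext' _ _ fun j => by rw [biproduct.ι_desc_assoc, biproduct.ι_desc]
    · rw [biprod.inr_desc_assoc, Category.comp_id]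
      exact biproduct.hom_ext' _ _ fun j => by rw [biproduct.ι_desc_assoc, biproduct.ι_desc]
  inv_hom_id := by
    apply biproduct.hom_ext'
    rintro (j | j)
    · rw [biproduct.ι_desc_assoc, Category.comp_id]
      dsimp only
      rw [Category.assoc, biprod.inl_desc, biproduct.ι_desc]
    · rw [biproduct.ι_desc_assoc, Category.comp_id]
      dsimp only
      rw [Category.assoc, biprod.inr_desc, biproduct.ι_desc]

variable (k) in
lemma exists_krullSchmidtDecomposition [∀ X Y : C, Module.Finite k (X ⟶ Y)] (M : C) :
    ∃ (n : ℕ) (f : Fin n → C), IsKrullSchmidtDecomposition M f := by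
  suffices ∀ (d : ℕ) (M : C), Module.finrank k (M ⟶ M) = d → ∃ (J : Type) (_ : Finite J)
      (f : J → C), (∀ j, Indecomposable (f j)) ∧ Nonempty (M ≅ ⨁ f) by
    obtain ⟨J, _, f, hf, ⟨e⟩⟩ := this _ M rfl
    obtain ⟨n, ⟨ε⟩⟩ := Finite.exists_equiv_fin J
    exact ⟨n, f ∘ ε.symm, fun i => hf _,
      ⟨e ≪≫ (biproduct.whiskerEquiv ε.symm fun _ => Iso.refl _).symm⟩⟩
  intro d
  induction d using Nat.strong_induction_on with
  | _ d ih =>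
  intro M hM
  by_cases h0 : IsZero M
  · refine ⟨Empty, inferInstance, Empty.elim, fun j => j.elim, ⟨h0.iso ?_⟩⟩
    rw [IsZero.iff_id_eq_zero]
    exact biproduct.hom_ext _ _ fun j => j.elim
  by_cases hI : Indecomposable M
  · exact ⟨Unit, inferInstance, fun _ => M, fun _ => hI,
      ⟨(biproductUniqueIso fun _ : Unit => M).symm⟩⟩
  obtain ⟨Y, Z, e, hY, hZ⟩ : ∃ (Y Z : C) (_ : M ≅ Y ⊞ Z), ¬ IsZero Y ∧ ¬ IsZero Z := by
    by_contra! h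
    exact hI ⟨h0, fun Y Z e => or_iff_not_imp_left.2 (h Y Z e)⟩
  -- `End Y × End Z` embeds block-diagonally into `End M` and both factors are nonzero, so each has
  -- smaller dimension than `End M`.
  let φ : ((Y ⟶ Y) × (Z ⟶ Z)) →ₗ[k] (M ⟶ M) :=
    { toFun p := e.hom ≫ biprod.map p.1 p.2 ≫ e.inv
      map_add' p q := by
        rw [← Preadditive.comp_add, ← Preadditive.add_comp]
        congr 2
        ext <;> simp
      map_smul' c p := by
        dsimp
        rw [← Linear.comp_smul, ← Linear.smul_comp]
        congr 2
        ext <;> simp }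
  have hφ : Function.Injective φ := by
    intro p q hpq
    have h : biprod.map p.1 p.2 = biprod.map q.1 q.2 :=
      (cancel_mono e.inv).1 ((cancel_epi e.hom).1 hpq)
    ext
    · simpa using biprod.inl ≫= h =≫ biprod.fst
    · simpa using biprod.inr ≫= h =≫ biprod.snd
  have hd := LinearMap.finrank_le_finrank_of_injective hφ
  rw [Module.finrank_prod, hM] at hd
  have hpos (X : C) (hX : ¬ IsZero X) : 0 < Module.finrank k (X ⟶ X) := by
    have : Nontrivial (X ⟶ X) := ⟨𝟙 X, 0, fun h => hX ((IsZero.iff_id_eq_zero X).2 h)⟩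
    exact Module.finrank_pos
  have := hpos Y hY
  have := hpos Z hZ
  obtain ⟨J, _, f, hf, ⟨ef⟩⟩ := ih _ (by lia) Y rfl
  obtain ⟨J', _, g, hg, ⟨eg⟩⟩ := ih _ (by lia) Z rfl
  refine ⟨J ⊕ J', inferInstance, Sum.elim f g, ?_, ⟨e ≪≫ biprod.mapIso ef eg ≪≫
    biproductSumIso (Sum.elim f g)⟩⟩
  rintro (j | j)
  · exact hf j
  · exact hg j

/-- The right side involves no decomposition, so the multiplicity does not depend on one; the
infimum is attained because decompositions exist. -/
lemma summandMultiplicity_mul [∀ X Y : C, Module.Finite k (X ⟶ Y)] {T : C}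
    [Module.Finite k (End T)] (hT : Indecomposable T) (M : C) :
    summandMultiplicity M T * radRank k hT T = radRank k hT M := by
  obtain ⟨n, f, hf⟩ := exists_krullSchmidtDecomposition k M
  obtain ⟨n', f', hf', h⟩ := Nat.sInf_mem (s := {m | ∃ (n : ℕ) (f : Fin n → C),
    IsKrullSchmidtDecomposition M f ∧ m = Nat.card {i // Nonempty (f i ≅ T)}}) ⟨_, n, f, hf, rfl⟩
  rw [radRank_eq_card_mul hT hf', ← h]
  rfl

section Additivity

lemma summandMultiplicity_iso (k : Type w) [Field k] [Linear k C]
    [∀ X Y : C, Module.Finite k (X ⟶ Y)] {T : C} (hT : Indecomposable T) {M N : C} (e : M ≅ N) :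
    summandMultiplicity M T = summandMultiplicity N T := by
  have : Module.Finite k (End T) := inferInstanceAs (Module.Finite k (T ⟶ T))
  refine Nat.eq_of_mul_eq_mul_right (radRank_self_pos (k := k) hT) ?_
  rw [summandMultiplicity_mul hT, summandMultiplicity_mul hT, radRank_iso hT e]

lemma summandMultiplicity_biprod (k : Type w) [Field k] [Linear k C]
    [∀ X Y : C, Module.Finite k (X ⟶ Y)] {T : C} (hT : Indecomposable T) (M N : C) :
    summandMultiplicity (M ⊞ N) T = summandMultiplicity M T + summandMultiplicity N T := by
  have : Module.Finite k (End T) := inferInstanceAs (Module.Finite k (T ⟶ T))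
  refine Nat.eq_of_mul_eq_mul_right (radRank_self_pos (k := k) hT) ?_
  rw [add_mul, summandMultiplicity_mul hT, summandMultiplicity_mul hT, summandMultiplicity_mul hT,
    radRank_biprod]

lemma summandMultiplicity_le_of_isDirectSummand (k : Type w) [Field k] [Linear k C]
    [∀ X Y : C, Module.Finite k (X ⟶ Y)] {T : C} (hT : Indecomposable T) {M N : C}
    (h : IsDirectSummand M N) : summandMultiplicity M T ≤ summandMultiplicity N T := by
  obtain ⟨W, ⟨e⟩⟩ := h
  rw [← summandMultiplicity_iso k hT e, summandMultiplicity_biprod k hT]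
  exact Nat.le_add_right _ _

end Additivity

end KrullSchmidt

end

section

open Abelian DerivedCategory

/-! ### Minimal complexes as summands of homotopy equivalent complexes -/

section MinimalComplexes

/-- The left inverse `s` of `x + 1` equals `1 - s * x`, so it has a left inverse too, which must be
`x + 1`. -/
lemma isUnit_add_one_of_mem_jacobson {R : Type*} [Ring R] {x : R} (hx : x ∈ Ring.jacobson R) :
    IsUnit (x + 1) := by
  rw [← Ideal.jacobson_bot] at hx
  have key (y : R) (hy : y ∈ Ideal.jacobson (⊥ : Ideal R)) : ∃ s, s * (y + 1) = 1 := by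
    obtain ⟨s, hs⟩ := Ideal.exists_mul_add_sub_mem_of_mem_jacobson y hy
    exact ⟨s, sub_eq_zero.1 hs⟩
  obtain ⟨s, hs⟩ := key x hx
  obtain ⟨r, hr⟩ := key (-(s * x)) (neg_mem (Ideal.mul_mem_left _ s hx))
  have h : -(s * x) + 1 = s := by rw [← hs, mul_add, mul_one]; abel
  rw [h] at hr
  have : r = x + 1 := by
    calc r = r * (s * (x + 1)) := by rw [hs, mul_one]
      _ = x + 1 := by rw [← mul_assoc, hr, one_mul]
  exact ⟨⟨x + 1, s, this ▸ hr, hs⟩, rfl⟩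

lemma IsMinimalComplex.isIso_of_homotopy_id {A : Type u} [Category.{v} A] [Preadditive A]
    {K : CochainComplex A ℤ} (hK : IsMinimalComplex K) {s : K ⟶ K} (h : Homotopy s (𝟙 K)) :
    IsIso s := by
  have (i : ℤ) : IsIso (s.f i) := by
    have h₁ : End.of (K.d i (i + 1) ≫ h.hom (i + 1) i) ∈ Ring.jacobson (End (K.X i)) := by
      simpa only [Category.id_comp] using hK i (𝟙 _) (h.hom (i + 1) i)
    have h₂ : End.of (h.hom i (i - 1) ≫ K.d (i - 1) i) ∈ Ring.jacobson (End (K.X i)) := by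
      have := hK (i - 1)
      rw [sub_add_cancel] at this
      simpa only [Category.comp_id] using this (h.hom i (i - 1)) (𝟙 _)
    have hs := h.comm i
    rw [dNext_eq h.hom (show (ComplexShape.up ℤ).Rel i (i + 1) by simp),
      prevD_eq h.hom (show (ComplexShape.up ℤ).Rel (i - 1) i by simp)] at hs
    rw [hs]
    exact (isUnit_iff_isIso _).1 (isUnit_add_one_of_mem_jacobson (add_mem h₁ h₂))
  exact HomologicalComplex.Hom.isIso_of_components s

variable {C : Type u} [Category.{v} C] [Abelian C]

/-- Minimality refers to the radical of the subcategory, so the homotopy is first pulled back along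
the fully faithful inclusion. -/
lemma IsMinimalComplex.isIso_of_homotopy_id_obj {P : ObjectProperty C}
    {K : CochainComplex P.FullSubcategory ℤ} (hK : IsMinimalComplex K)
    {s : (P.ι.mapHomologicalComplex (ComplexShape.up ℤ)).obj K ⟶
      (P.ι.mapHomologicalComplex (ComplexShape.up ℤ)).obj K} (h : Homotopy s (𝟙 _)) :
    IsIso s := by
  obtain ⟨s, rfl⟩ := (P.ι.mapHomologicalComplex (ComplexShape.up ℤ)).map_surjective s
  rw [← (P.ι.mapHomologicalComplex (ComplexShape.up ℤ)).map_id] at h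
  have := hK.isIso_of_homotopy_id (P.ι.preimageHomotopy h)
  infer_instance

lemma IsBoundedComplex.obj {P : ObjectProperty C} {K : CochainComplex P.FullSubcategory ℤ}
    (hK : IsBoundedComplex K) :
    IsBoundedComplex ((P.ι.mapHomologicalComplex (ComplexShape.up ℤ)).obj K) := by
  obtain ⟨a, b, h⟩ := hK
  exact ⟨a, b, fun i hi => P.ι.map_isZero (h i hi)⟩

lemma IsBoundedComplex.mappingCone {K M : CochainComplex C ℤ} (hK : IsBoundedComplex K)
    (hM : IsBoundedComplex M) (f : K ⟶ M) : IsBoundedComplex (CochainComplex.mappingCone f) := by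
  obtain ⟨a, b, hK⟩ := hK
  obtain ⟨a', b', hM⟩ := hM
  refine ⟨min (a - 1) a', max b b', fun i hi => ?_⟩
  rw [CochainComplex.mappingCone.isZero_X_iff]
  exact ⟨hK _ (by lia), hM _ (by lia)⟩

/-- The terms of a mapping cone. -/
def mappingConeXIso {K M : CochainComplex C ℤ} (f : K ⟶ M) (i : ℤ) :
    (CochainComplex.mappingCone f).X i ≅ K.X (i + 1) ⊞ M.X i :=
  HomologicalComplex.homotopyCofiber.XIsoBiprod f i (i + 1) rfl

section Retract

variable {K M : CochainComplex C ℤ} {φ : K ⟶ M} {ψ : M ⟶ K}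

/-- The complement of a homotopy equivalent direct summand of a complex is contractible, hence
its terms are direct summands of the adjacent terms. -/
lemma isDirectSummand_kernel_of_homotopy (hφψ : φ ≫ ψ = 𝟙 K) (h : Homotopy (ψ ≫ φ) (𝟙 M))
    (i : ℤ) : IsDirectSummand (kernel (ψ.f i)) (M.X (i + 1) ⊞ M.X (i - 1)) := by
  have hs := h.comm i
  rw [dNext_eq h.hom (show (ComplexShape.up ℤ).Rel i (i + 1) by simp),
    prevD_eq h.hom (show (ComplexShape.up ℤ).Rel (i - 1) i by simp)] at hs
  have hφψ' : φ.f i ≫ ψ.f i = 𝟙 _ := by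
    rw [← HomologicalComplex.comp_f, hφψ, HomologicalComplex.id_f]
  let π : M.X i ⟶ kernel (ψ.f i) := kernel.lift _ (𝟙 _ - ψ.f i ≫ φ.f i) (by
    rw [Preadditive.sub_comp, Category.id_comp, Category.assoc, hφψ', Category.comp_id, sub_self])
  have hπ : π ≫ kernel.ι (ψ.f i) = 𝟙 _ - ψ.f i ≫ φ.f i := kernel.lift_ι _ _ _
  -- On `kernel (ψ.f i)` the map `ψ ≫ φ - 𝟙` is `-𝟙`. It also equals `d ≫ h + h ≫ d`, so the
  -- identity factors through the neighbouring terms, with the minus signs below.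
  refine isDirectSummand_of_retract
    (biprod.lift (kernel.ι (ψ.f i) ≫ M.d i (i + 1)) (kernel.ι (ψ.f i) ≫ h.hom i (i - 1)))
    (biprod.desc (-(h.hom (i + 1) i ≫ π)) (-(M.d (i - 1) i ≫ π))) ?_
  have hd : M.d i (i + 1) ≫ h.hom (i + 1) i + h.hom i (i - 1) ≫ M.d (i - 1) i =
      ψ.f i ≫ φ.f i - 𝟙 _ := by
    rw [← HomologicalComplex.comp_f, hs, HomologicalComplex.id_f, add_sub_cancel_right]
  have hι : kernel.ι (ψ.f i) ≫ (ψ.f i ≫ φ.f i - 𝟙 _) = - kernel.ι (ψ.f i) := by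
    rw [Preadditive.comp_sub, kernel.condition_assoc, zero_comp, Category.comp_id, zero_sub]
  have : kernel.ι (ψ.f i) ≫ π = 𝟙 _ := by
    rw [← cancel_mono (kernel.ι (ψ.f i)), Category.assoc, hπ, ← neg_sub, Preadditive.comp_neg, hι,
      neg_neg, Category.id_comp]
  rw [biprod.lift_desc, Preadditive.comp_neg, Preadditive.comp_neg, ← neg_add, ← Category.assoc,
    ← Category.assoc, ← Preadditive.add_comp, Category.assoc, Category.assoc,
    ← Preadditive.comp_add, hd, hι, Preadditive.neg_comp, neg_neg, this]

/-- Replacing `ψ` by `ψ ≫ inv s` makes the retraction strict; `inv s` is trivial up to homotopy, so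
the other composite remains homotopic to the identity. -/
lemma exists_retraction_of_isIso {s : K ⟶ K} (hs : φ ≫ ψ = s) [IsIso s] (hs' : Homotopy s (𝟙 K))
    (h : Homotopy (ψ ≫ φ) (𝟙 M)) :
    ∃ ψ' : M ⟶ K, φ ≫ ψ' = 𝟙 K ∧ Nonempty (Homotopy (ψ' ≫ φ) (𝟙 M)) := by
  refine ⟨ψ ≫ inv s, by rw [← Category.assoc, hs, IsIso.hom_inv_id], ?_⟩
  let q := HomotopyCategory.quotient C (ComplexShape.up ℤ)
  have h₁ : q.map s = 𝟙 _ := (HomotopyCategory.eq_of_homotopy _ _ hs').trans (q.map_id K)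
  have h₂ : q.map (inv s) = 𝟙 _ := by
    rw [Functor.map_inv, IsIso.inv_eq_of_hom_inv_id]
    rw [h₁, Category.comp_id]
  refine ⟨HomotopyCategory.homotopyOfEq _ _ ?_⟩
  change q.map _ = q.map _
  rw [← HomotopyCategory.eq_of_homotopy _ _ h, q.map_comp, q.map_comp, q.map_comp, h₂,
    Category.comp_id]

end Retract

section DerivedCategory

variable [HasDerivedCategory.{t'} C] {K M : CochainComplex C ℤ}

lemma exists_Q_map_eq (h : MapBij Qh ((HomotopyCategory.quotient C (ComplexShape.up ℤ)).obj K)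
    ((HomotopyCategory.quotient C (ComplexShape.up ℤ)).obj M)) (g : Q.obj K ⟶ Q.obj M) :
    ∃ f : K ⟶ M, Q.map f = g := by
  obtain ⟨f, hf⟩ := h.2 ((quotientCompQhIso C).hom.app K ≫ g ≫ (quotientCompQhIso C).inv.app M)
  obtain ⟨f, rfl⟩ := (HomotopyCategory.quotient C (ComplexShape.up ℤ)).map_surjective f
  refine ⟨f, ?_⟩
  have := quotientCompQhIso_hom_naturality f
  rw [hf] at this
  simpa using this.symm

lemma homotopy_of_Q_map_eq (h : MapBij Qh
    ((HomotopyCategory.quotient C (ComplexShape.up ℤ)).obj K)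
    ((HomotopyCategory.quotient C (ComplexShape.up ℤ)).obj M)) {f g : K ⟶ M}
    (hfg : Q.map f = Q.map g) : Nonempty (Homotopy f g) := by
  refine ⟨HomotopyCategory.homotopyOfEq _ _ (h.1 ?_)⟩
  have hf := quotientCompQhIso_hom_naturality f
  rw [hfg, ← quotientCompQhIso_hom_naturality g] at hf
  exact (cancel_mono _).1 hf

/-- A minimal complex is a homotopy equivalent direct summand of every isomorphic object of the
derived category, if morphisms can be computed in the homotopy category. -/
lemma IsMinimalComplex.exists_retraction {P : ObjectProperty C}
    {K : CochainComplex P.FullSubcategory ℤ} (hK : IsMinimalComplex K) {M : CochainComplex C ℤ}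
    (hext : ∀ N N' : CochainComplex C ℤ,
      (N = (P.ι.mapHomologicalComplex (ComplexShape.up ℤ)).obj K ∨ N = M) →
      (N' = (P.ι.mapHomologicalComplex (ComplexShape.up ℤ)).obj K ∨ N' = M) →
      MapBij Qh ((HomotopyCategory.quotient C (ComplexShape.up ℤ)).obj N)
        ((HomotopyCategory.quotient C (ComplexShape.up ℤ)).obj N'))
    (e : Q.obj ((P.ι.mapHomologicalComplex (ComplexShape.up ℤ)).obj K) ≅ Q.obj M) :
    ∃ (φ : (P.ι.mapHomologicalComplex (ComplexShape.up ℤ)).obj K ⟶ M)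
      (ψ : M ⟶ (P.ι.mapHomologicalComplex (ComplexShape.up ℤ)).obj K),
      φ ≫ ψ = 𝟙 _ ∧ Nonempty (Homotopy (ψ ≫ φ) (𝟙 M)) := by
  -- Fullness lifts `e` and its inverse; faithfulness on both endomorphism groups turns the two
  -- identities into homotopies.
  obtain ⟨φ, hφ⟩ := exists_Q_map_eq (hext _ _ (.inl rfl) (.inr rfl)) e.hom
  obtain ⟨ψ, hψ⟩ := exists_Q_map_eq (hext _ _ (.inr rfl) (.inl rfl)) e.inv
  obtain ⟨h₁⟩ := homotopy_of_Q_map_eq (f := φ ≫ ψ) (g := 𝟙 _) (hext _ _ (.inl rfl) (.inl rfl))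
    (by rw [Functor.map_comp, hφ, hψ, e.hom_inv_id, CategoryTheory.Functor.map_id])
  obtain ⟨h₂⟩ := homotopy_of_Q_map_eq (f := ψ ≫ φ) (g := 𝟙 _) (hext _ _ (.inr rfl) (.inr rfl))
    (by rw [Functor.map_comp, hφ, hψ, e.inv_hom_id, CategoryTheory.Functor.map_id])
  have := hK.isIso_of_homotopy_id_obj h₁
  exact ⟨φ, exists_retraction_of_isIso rfl h₁ h₂⟩

lemma exists_mappingCone_iso {T : Triangle (DerivedCategory C)} (hT : T ∈ distTriang _)
    (h : MapBij Qh ((HomotopyCategory.quotient C (ComplexShape.up ℤ)).obj K)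
      ((HomotopyCategory.quotient C (ComplexShape.up ℤ)).obj M))
    (e₁ : Q.obj K ≅ T.obj₁) (e₂ : Q.obj M ≅ T.obj₂) :
    ∃ f : K ⟶ M, Nonempty (Q.obj (CochainComplex.mappingCone f) ≅ T.obj₃) := by
  obtain ⟨f, hf⟩ := exists_Q_map_eq h (e₁.hom ≫ T.mor₁ ≫ e₂.inv)
  refine ⟨f, ⟨Triangle.π₃.mapIso (isoTriangleOfIso₁₂ _ _
    (mappingCone_triangle_distinguished f) hT e₁ e₂ ?_)⟩⟩
  change Q.map f ≫ e₂.hom = e₁.hom ≫ T.mor₁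
  simp [hf]

end DerivedCategory

section ExtBiprod

lemma shortExact_biprod (X Y : C) :
    (ShortComplex.mk (biprod.inl : X ⟶ X ⊞ Y) biprod.snd biprod.inl_snd).ShortExact :=
  (ShortComplex.Splitting.ofHasBinaryBiproduct X Y).shortExact

variable [HasExt.{t} C]

lemma ext_left_biprod {X X' Y : C} {n : ℕ} (h : Subsingleton (Ext X Y n))
    (h' : Subsingleton (Ext X' Y n)) : Subsingleton (Ext (X ⊞ X') Y n) :=
  ext_left_X₂ (shortExact_biprod X X') h h'

lemma ext_right_biprod {X Y Y' : C} {n : ℕ} (h : Subsingleton (Ext X Y n))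
    (h' : Subsingleton (Ext X Y' n)) : Subsingleton (Ext X (Y ⊞ Y') n) :=
  ext_right_X₂ (shortExact_biprod Y Y') h h'

end ExtBiprod

variable {k : Type w} [Field k] [Linear k C] [HasExt.{t} C] [HasDerivedCategory.{t'} C]
  {Λ : Type w'} [PartialOrder Λ]

/-- The minimal tilting complex of the cone of a morphism is a homotopy equivalent direct summand
of the mapping cone of a morphism between the minimal tilting complexes. -/
lemma exists_retraction_mappingCone (H : HighestWeightCategory C k Λ)
    (D : Triangle (BoundedDerivedCategory C)) (hD : D ∈ distTriang _)
    {KX KY KZ : CochainComplex H.Tilt ℤ} (hX : IsMinimalTiltingComplex H KX D.obj₁)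
    (hY : IsMinimalTiltingComplex H KY D.obj₂) (hZ : IsMinimalTiltingComplex H KZ D.obj₃) :
    ∃ (f : (H.tilting.ι.mapHomologicalComplex (ComplexShape.up ℤ)).obj KX ⟶
        (H.tilting.ι.mapHomologicalComplex (ComplexShape.up ℤ)).obj KY)
      (φ : (H.tilting.ι.mapHomologicalComplex (ComplexShape.up ℤ)).obj KZ ⟶
        CochainComplex.mappingCone f)
      (ψ : CochainComplex.mappingCone f ⟶
        (H.tilting.ι.mapHomologicalComplex (ComplexShape.up ℤ)).obj KZ),
      φ ≫ ψ = 𝟙 _ ∧ Nonempty (Homotopy (ψ ≫ φ) (𝟙 _)) := by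
  have hD' := (DerivedCategory.TStructure.t (C := C)).bounded.ι.map_distinguished D hD
  have hext (K K' : CochainComplex H.Tilt ℤ) (i j : ℤ) (n : ℕ) :
      Subsingleton (Ext (K.X i).obj (K'.X j).obj (n + 1)) :=
    H.ext_tilting_eq_zero (K.X i).property (K'.X j).property n
  obtain ⟨f, ⟨e⟩⟩ := exists_mappingCone_iso hD'
    (mapBij_Qh_of_ext hX.bounded.obj hY.bounded.obj (hext KX KY)) hX.iso.some hY.iso.some
  -- `Ext` vanishing passes to the cone terms because they are biproducts, so these terms need not
  -- be shown to be tilting.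
  have hl (K : CochainComplex H.Tilt ℤ) (i j : ℤ) (n : ℕ) :
      Subsingleton (Ext ((CochainComplex.mappingCone f).X i) (K.X j).obj (n + 1)) :=
    ext_left_of_iso (mappingConeXIso f i)
      (ext_left_biprod (hext KX K (i + 1) j n) (hext KY K i j n))
  have hr (K : CochainComplex H.Tilt ℤ) (i j : ℤ) (n : ℕ) :
      Subsingleton (Ext (K.X i).obj ((CochainComplex.mappingCone f).X j) (n + 1)) :=
    ext_right_of_iso (mappingConeXIso f j)
      (ext_right_biprod (hext K KX i (j + 1) n) (hext K KY i j n))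
  have hlr (i j : ℤ) (n : ℕ) : Subsingleton (Ext ((CochainComplex.mappingCone f).X i)
      ((CochainComplex.mappingCone f).X j) (n + 1)) :=
    ext_left_of_iso (mappingConeXIso f i) (ext_left_biprod (hr KX (i + 1) j n) (hr KY i j n))
  have hb := hX.bounded.obj.mappingCone hY.bounded.obj f
  refine ⟨f, hZ.minimal.exists_retraction ?_ (hZ.iso.some ≪≫ e.symm)⟩
  rintro N N' (rfl | rfl) (rfl | rfl)
  · exact mapBij_Qh_of_ext hZ.bounded.obj hZ.bounded.obj (hext KZ KZ)
  · exact mapBij_Qh_of_ext hZ.bounded.obj hb (hr KZ)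
  · exact mapBij_Qh_of_ext hb hZ.bounded.obj (hl KZ)
  · exact mapBij_Qh_of_ext hb hb hlr

end MinimalComplexes

end

end MinTilt

end

/-! ### The main theorem -/

theorem mainTheorem9 {k : Type w} [Field k]
    {C : Type u} [Category.{v} C] [Abelian C] [Linear k C]
    [HasExt.{t} C] [HasDerivedCategory.{t'} C]
    {Λ : Type w'} [PartialOrder Λ] (H : MinTilt.HighestWeightCategory C k Λ)
    (D : Triangle (MinTilt.BoundedDerivedCategory C)) (hD : D ∈ distTriang _)
    (KX KY KZ : CochainComplex H.Tilt ℤ)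
    (hX : MinTilt.IsMinimalTiltingComplex H KX D.obj₁)
    (hY : MinTilt.IsMinimalTiltingComplex H KY D.obj₂)
    (hZ : MinTilt.IsMinimalTiltingComplex H KZ D.obj₃) (i : ℤ) :
    MinTilt.IsDirectSummand (KZ.X i).obj ((KX.X (i + 1)).obj ⊞ (KY.X i).obj) ∧
    ∀ (l : Λ) (T : C), H.IsIndecomposableTilting l T →
      MinTilt.summandMultiplicity (KZ.X i).obj T ≤
        MinTilt.summandMultiplicity (KX.X (i + 1)).obj T +
          MinTilt.summandMultiplicity (KY.X i).obj T ∧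
      (MinTilt.summandMultiplicity (KX.X (i + 1)).obj T : ℤ)
          - MinTilt.summandMultiplicity (KX.X i).obj T
          - MinTilt.summandMultiplicity (KX.X (i + 2)).obj T
          + MinTilt.summandMultiplicity (KY.X i).obj T
          - MinTilt.summandMultiplicity (KY.X (i - 1)).obj T
          - MinTilt.summandMultiplicity (KY.X (i + 1)).obj T ≤
        (MinTilt.summandMultiplicity (KZ.X i).obj T : ℤ) := by
  obtain ⟨f, φ, ψ, hφψ, ⟨h⟩⟩ := MinTilt.exists_retraction_mappingCone H D hD hX hY hZ
  have hφψ' (i : ℤ) : φ.f i ≫ ψ.f i = 𝟙 _ := by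
    rw [← HomologicalComplex.comp_f, hφψ, HomologicalComplex.id_f]
  have hds : MinTilt.IsDirectSummand (KZ.X i).obj ((KX.X (i + 1)).obj ⊞ (KY.X i).obj) := by
    obtain ⟨W, ⟨e⟩⟩ := MinTilt.isDirectSummand_of_retract _ _ (hφψ' i)
    exact ⟨W, ⟨e ≪≫ MinTilt.mappingConeXIso f i⟩⟩
  refine ⟨hds, fun l T hT => ?_⟩
  replace hT := hT.indecomposable
  have := H.finite_hom
  have hcone (j : ℤ) : MinTilt.summandMultiplicity ((CochainComplex.mappingCone f).X j) T =
      MinTilt.summandMultiplicity (KX.X (j + 1)).obj T +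
        MinTilt.summandMultiplicity (KY.X j).obj T :=
    (MinTilt.summandMultiplicity_iso k hT (MinTilt.mappingConeXIso f j)).trans
      (MinTilt.summandMultiplicity_biprod k hT _ _)
  have hker := MinTilt.summandMultiplicity_le_of_isDirectSummand k hT
    (MinTilt.isDirectSummand_kernel_of_homotopy hφψ h i)
  have hsplit : MinTilt.summandMultiplicity ((CochainComplex.mappingCone f).X i) T =
      MinTilt.summandMultiplicity (kernel (ψ.f i)) T +
        MinTilt.summandMultiplicity (KZ.X i).obj T :=
    (MinTilt.summandMultiplicity_iso k hT
      (MinTilt.isoBiprodOfRetract _ _ (hφψ' i))).trans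
        (MinTilt.summandMultiplicity_biprod k hT _ _)
  -- The cone terms of degrees `i + 1` and `i - 1` consist of `X_{i+2}`, `Y_{i+1}` and `X_i`,
  -- `Y_{i-1}`, the four terms subtracted in the lower bound.
  rw [MinTilt.summandMultiplicity_biprod k hT, hcone, hcone, sub_add_cancel, add_assoc i 1 1,
    one_add_one_eq_two] at hker
  rw [hcone] at hsplit
  lia
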